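/- Let $\mathcal{A}$ be an additive category (a category enriched in abelian groups in which any two objects have a direct sum), let $\Phi\colon\mathcal{A}\to\mathcal{A}$ be an automorphism of additive categories, and let $l\ge 0$ be a natural number. Let $\mathcal{A}_\Phi[t,t^{-1}]$ be the category with the same objects as $\mathcal{A}$, in which a morphism $A\to B$ is a finite formal sum $\sum_{i\in\mathbb{Z}} f_i\cdot t^i$ with $f_i\colon\Phi^i(A)\to B$ in $\mathcal{A}$, addition is coefficientwise, and composition is given by \[ \Bigl(\sum_j g_j\cdot t^j\Bigr)\circ\Bigl(\sum_i f_i\cdot t^i\Bigr)=\sum_k\Bigl(\sum_{i+j=k} g_j\circ\Phi^j(f_i)\Bigr)\cdot t^k . \] Let $\mathcal{A}_\Phi[t]$ be its subcategory with all objects and with the morphisms satisfying $f_i=0$ for all $i<0$. Both are additive categories. For an additive category $\mathcal{B}$, a $\mathbb{Z}\mathcal{B}$-module is a contravariant additive functor from $\mathcal{B}$ to abelian groups; exactness, injectivity and surjectivity are objectwise. A module is finitely generated free if it is isomorphic to a finite direct sum $\bigoplus_j \mathrm{mor}_{\mathcal{B}}(?,B_j)$, finitely generated if it is a quotient of such a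 module, and finitely presented if there is an exact sequence $F_1\to F_0\to M\to 0$ with $F_0,F_1$ finitely generated free. An $l$-dimensional finite projective resolution of $M$ is an exact sequence $0\to P_l\to\cdots\to P_0\to M\to 0$ with every $P_i$ finitely generated projective. The category $\mathcal{B}$ is Noetherian if every submodule of a finitely generated $\mathbb{Z}\mathcal{B}$-module is finitely generated. It is regular if it is Noetherian and every finitely presented $\mathbb{Z}\mathcal{B}$-module has an $n$-dimensional finite projective resolution for some natural number $n$ (depending on the module). It is $l$-uniformly regular if it is Noetherian and every finitely presented $\mathbb{Z}\mathcal{B}$-module has an $l$-dimensional finite projective resolution. Then: 1. If $\mathcal{A}$ is regular, then $\mathcal{A}_\Phi[t]$ is regular. If $\mathcal{A}$ is $l$-uniformly regular, then $\mathcal{A}_\Phi[t]$ is $(l+2)$-uniformly regular. 2. If $\mathcal{A}_\Phi[t]$ is regular, then $\mathcal{A}_\Phi[t,t^{-1}]$ is regular. If $\mathcal{A}_\Phi[t]$ is $l$-uniformly regular, then $\mathcal{A}_\Phi[t,t^{-1}]$ is $l$-uniformly regular. -/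

import Mathlib

open CategoryTheory Opposite
open scoped DirectSum

universe v u

/-! ### Automorphisms of additive categories -/

/-- A (strict) automorphism of the preadditive category `A`: an additive functor `A ⥤ A` that has
a strict two-sided inverse. -/
@[ext]
structure AdditiveAutomorphism (A : Type u) [Category.{v} A] [Preadditive A] where
  hom : A ⥤ A
  inv : A ⥤ A
  hom_inv_id : hom ⋙ inv = 𝟭 A
  inv_hom_id : inv ⋙ hom = 𝟭 A
  additive : hom.Additive

namespace AdditiveAutomorphism

variable {A : Type u} [Category.{v} A] [Preadditive A]

instance (Φ : AdditiveAutomorphism A) : Φ.hom.Additive := Φ.additive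

theorem ext_hom {Φ Ψ : AdditiveAutomorphism A} (h : Φ.hom = Ψ.hom) : Φ = Ψ := by
  have h' : Φ.inv = Ψ.inv := by
    calc Φ.inv = Φ.inv ⋙ (Ψ.hom ⋙ Ψ.inv) := by rw [Ψ.hom_inv_id]; rfl
      _ = (Φ.inv ⋙ Φ.hom) ⋙ Ψ.inv := by rw [h]; rfl
      _ = Ψ.inv := by rw [Φ.inv_hom_id]; rfl
  exact AdditiveAutomorphism.ext h h'

theorem hom_map_injective (Φ : AdditiveAutomorphism A) {X Y : A} {f g : X ⟶ Y}
    (h : Φ.hom.map f = Φ.hom.map g) : f = g := by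
  have hf := Functor.congr_hom Φ.hom_inv_id f
  have hg := Functor.congr_hom Φ.hom_inv_id g
  simp only [Functor.comp_map, Functor.id_map] at hf hg
  rw [h, hg] at hf
  exact ((cancel_epi _).1 ((cancel_mono _).1 (by simpa only [Category.assoc] using hf))).symm

theorem inv_additive (Φ : AdditiveAutomorphism A) : Φ.inv.Additive where
  map_add {X Y f g} := by
    apply Φ.hom_map_injective
    have hf := Functor.congr_hom Φ.inv_hom_id f
    have hg := Functor.congr_hom Φ.inv_hom_id g
    have hfg := Functor.congr_hom Φ.inv_hom_id (f + g)
    simp only [Functor.comp_map, Functor.id_map] at hf hg hfg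
    rw [Φ.hom.map_add, hf, hg, hfg]
    simp [Preadditive.add_comp, Preadditive.comp_add]

/-- The group of automorphisms of `A`; the product is the composition, `(Φ * Ψ)(X) = Φ(Ψ(X))`.
In particular the powers `Φ ^ i` with `i : ℤ` are defined. -/
instance : Group (AdditiveAutomorphism A) where
  mul Φ Ψ :=
    { hom := Ψ.hom ⋙ Φ.hom
      inv := Φ.inv ⋙ Ψ.inv
      hom_inv_id := by
        change Ψ.hom ⋙ (Φ.hom ⋙ Φ.inv) ⋙ Ψ.inv = _
        rw [Φ.hom_inv_id]; exact Ψ.hom_inv_id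
      inv_hom_id := by
        change Φ.inv ⋙ (Ψ.inv ⋙ Ψ.hom) ⋙ Φ.hom = _
        rw [Ψ.inv_hom_id]; exact Φ.inv_hom_id
      additive := inferInstance }
  one := ⟨𝟭 A, 𝟭 A, rfl, rfl, inferInstance⟩
  inv Φ := ⟨Φ.inv, Φ.hom, Φ.inv_hom_id, Φ.hom_inv_id, Φ.inv_additive⟩
  mul_assoc _ _ _ := rfl
  one_mul _ := rfl
  mul_one _ := rfl
  inv_mul_cancel Φ := ext_hom Φ.hom_inv_id

theorem zpow_zero_hom (Φ : AdditiveAutomorphism A) : (Φ ^ (0 : ℤ)).hom = 𝟭 A := by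
  rw [zpow_zero]; rfl

theorem zpow_add_hom (Φ : AdditiveAutomorphism A) (i j : ℤ) :
    (Φ ^ (i + j)).hom = (Φ ^ i).hom ⋙ (Φ ^ j).hom := by
  rw [add_comm, zpow_add]; rfl

theorem zpow_zero_obj (Φ : AdditiveAutomorphism A) (X : A) : (Φ ^ (0 : ℤ)).hom.obj X = X :=
  Functor.congr_obj Φ.zpow_zero_hom X

theorem zpow_add_obj (Φ : AdditiveAutomorphism A) (i j : ℤ) (X : A) :
    (Φ ^ (i + j)).hom.obj X = (Φ ^ j).hom.obj ((Φ ^ i).hom.obj X) :=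
  Functor.congr_obj (Φ.zpow_add_hom i j) X

end AdditiveAutomorphism

/-! ### The twisted finite Laurent category -/

/-- The objects of the `Φ`-twisted finite Laurent category `A_Φ[t, t⁻¹]`: those of `A`. -/
@[ext]
structure TwistedLaurent {A : Type u} [Category.{v} A] [Preadditive A]
    (Φ : AdditiveAutomorphism A) : Type u where
  obj : A

namespace TwistedLaurent

variable {A : Type u} [Category.{v} A] [Preadditive A] (Φ : AdditiveAutomorphism A)

/-- Morphisms `X ⟶ Y` in `A_Φ[t, t⁻¹]`: finite formal sums `∑ i, f i • t ^ i` with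
`f i : Φ ^ i X ⟶ Y` in `A`. -/
abbrev LHom (X Y : A) : Type v := ⨁ i : ℤ, ((Φ ^ i).hom.obj X ⟶ Y)

variable {Φ}

/-- The monomial `f • t ^ i`. -/
abbrev monomial {X Y : A} (i : ℤ) (f : (Φ ^ i).hom.obj X ⟶ Y) : LHom Φ X Y :=
  DirectSum.of (fun i : ℤ => ((Φ ^ i).hom.obj X ⟶ Y)) i f

/-- The coefficient `g ∘ Φ ^ j (f)` of the composite `(g • t ^ j) ∘ (f • t ^ i)`, where
`Φ ^ (i + j) X` and `Φ ^ j (Φ ^ i X)` are identified (they are equal). -/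
def coeffComp {X Y Z : A} {i j : ℤ} (f : (Φ ^ i).hom.obj X ⟶ Y) (g : (Φ ^ j).hom.obj Y ⟶ Z) :
    (Φ ^ (i + j)).hom.obj X ⟶ Z :=
  eqToHom (Φ.zpow_add_obj i j X) ≫ (Φ ^ j).hom.map f ≫ g

/-- Composition of twisted Laurent morphisms, as a biadditive map: `(f, g) ↦ g ∘ f` is
determined by `(g • t ^ j) ∘ (f • t ^ i) = (g ∘ Φ ^ j (f)) • t ^ (i + j)`. -/
noncomputable def compHom (X Y Z : A) : LHom Φ X Y →+ LHom Φ Y Z →+ LHom Φ X Z :=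
  DirectSum.toAddMonoid fun i => AddMonoidHom.flip <| DirectSum.toAddMonoid fun j =>
    AddMonoidHom.flip <| AddMonoidHom.mk' (fun f => AddMonoidHom.mk'
      (fun g => monomial (i + j) (coeffComp f g))
      (fun g g' => by simp [coeffComp, monomial, Preadditive.comp_add]))
      (fun f f' => by
        ext g : 1
        change monomial (i + j) (coeffComp (f + f') g) =
          monomial (i + j) (coeffComp f g) + monomial (i + j) (coeffComp f' g)
        simp [coeffComp, monomial, Preadditive.comp_add, Preadditive.add_comp, Functor.map_add])

theorem compHom_monomial {X Y Z : A} {i j : ℤ} (f : (Φ ^ i).hom.obj X ⟶ Y)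
    (g : (Φ ^ j).hom.obj Y ⟶ Z) :
    compHom X Y Z (monomial i f) (monomial j g) = monomial (i + j) (coeffComp f g) := by
  simp only [compHom, monomial, DirectSum.toAddMonoid_of, AddMonoidHom.flip_apply]
  rfl

/-- The identity `id • t ^ 0`. -/
noncomputable def idHom (X : A) : LHom Φ X X := monomial 0 (eqToHom (Φ.zpow_zero_obj X))

theorem monomial_congr {X Y : A} {i j : ℤ} (h : i = j) (f : (Φ ^ i).hom.obj X ⟶ Y)
    (g : (Φ ^ j).hom.obj X ⟶ Y) (hfg : f = eqToHom (by rw [h]) ≫ g) :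
    monomial i f = monomial j g := by
  subst h
  simp [hfg]

theorem compHom_id_left {X Y : A} (f : LHom Φ X Y) : compHom X X Y (idHom X) f = f := by
  induction f using DirectSum.induction_on with
  | zero => simp
  | add f g hf hg => rw [map_add, hf, hg]
  | of i f =>
    refine (compHom_monomial _ _).trans (monomial_congr (zero_add i) _ _ ?_)
    simp [coeffComp, eqToHom_map]

theorem compHom_id_right {X Y : A} (f : LHom Φ X Y) : compHom X Y Y f (idHom Y) = f := by
  induction f using DirectSum.induction_on with
  | zero => simp
  | add f g hf hg => rw [map_add, AddMonoidHom.add_apply, hf, hg]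
  | of i f =>
    refine (compHom_monomial _ _).trans (monomial_congr (add_zero i) _ _ ?_)
    have := Functor.congr_hom Φ.zpow_zero_hom f
    simp [coeffComp, this]

theorem compHom_assoc {X Y Z W : A} (f : LHom Φ X Y) (g : LHom Φ Y Z) (h : LHom Φ Z W) :
    compHom X Z W (compHom X Y Z f g) h = compHom X Y W f (compHom Y Z W g h) := by
  induction f using DirectSum.induction_on with
  | zero => simp
  | add f f' hf hf' => simp only [map_add, AddMonoidHom.add_apply, hf, hf']
  | of i f =>
  induction g using DirectSum.induction_on with
  | zero => simp
  | add g g' hg hg' => simp only [map_add, AddMonoidHom.add_apply, hg, hg']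
  | of j g =>
  induction h using DirectSum.induction_on with
  | zero => simp
  | add h h' hh hh' => simp only [map_add, hh, hh']
  | of k h =>
    have e₁ := compHom_monomial f g
    have e₂ := compHom_monomial g h
    simp only [monomial] at e₁ e₂
    rw [e₁, e₂]
    refine (compHom_monomial _ _).trans (Eq.trans ?_ (compHom_monomial _ _).symm)
    refine monomial_congr (add_assoc i j k) _ _ ?_
    have := Functor.congr_hom (Φ.zpow_add_hom j k) f
    simp [coeffComp, this, eqToHom_map]

noncomputable instance : Category.{v} (TwistedLaurent Φ) where
  Hom X Y := LHom Φ X.obj Y.obj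
  id X := idHom X.obj
  comp {X Y Z} f g := compHom X.obj Y.obj Z.obj f g
  id_comp f := compHom_id_left f
  comp_id f := compHom_id_right f
  assoc f g h := compHom_assoc f g h

noncomputable instance : Preadditive (TwistedLaurent Φ) where
  homGroup X Y := inferInstanceAs (AddCommGroup (LHom Φ X.obj Y.obj))
  add_comp X Y Z f f' g :=
    DFunLike.congr_fun ((compHom X.obj Y.obj Z.obj).map_add f f') g
  comp_add X Y Z f g g' := (compHom X.obj Y.obj Z.obj f).map_add g g'

/-- The coefficient `f i` of a morphism `f = ∑ i, f i • t ^ i`, additive in `f`. -/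
def coeff {X Y : TwistedLaurent Φ} (i : ℤ) : (X ⟶ Y) →+ ((Φ ^ i).hom.obj X.obj ⟶ Y.obj) :=
  DFinsupp.evalAddMonoidHom i

/-- The morphisms with `f i = 0` for all `i < 0`. -/
def nonneg (X Y : TwistedLaurent Φ) : AddSubgroup (X ⟶ Y) where
  carrier := {f | ∀ i < 0, coeff i f = 0}
  zero_mem' i _ := map_zero (coeff i)
  add_mem' {f g} hf hg i hi := by rw [map_add, hf i hi, hg i hi, add_zero]
  neg_mem' {f} hf i hi := by rw [map_neg, hf i hi, neg_zero]

theorem monomial_mem_nonneg {X Y : TwistedLaurent Φ} {i : ℤ} (hi : 0 ≤ i)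
    (f : (Φ ^ i).hom.obj X.obj ⟶ Y.obj) : (monomial i f : X ⟶ Y) ∈ nonneg X Y :=
  fun j hj => DirectSum.of_eq_of_ne (β := fun i : ℤ => ((Φ ^ i).hom.obj X.obj ⟶ Y.obj)) i j f (by omega)

theorem id_mem_nonneg (X : TwistedLaurent Φ) : 𝟙 X ∈ nonneg X X :=
  monomial_mem_nonneg le_rfl _

theorem comp_mem_nonneg {X Y Z : TwistedLaurent Φ} {f : X ⟶ Y} {g : Y ⟶ Z}
    (hf : f ∈ nonneg X Y) (hg : g ∈ nonneg Y Z) : f ≫ g ∈ nonneg X Z := by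
  classical
  have key : ∀ {X Y : TwistedLaurent Φ} {f : X ⟶ Y}, f ∈ nonneg X Y →
      ∃ s : Finset ℤ, (∀ i ∈ s, 0 ≤ i) ∧
        f = ∑ i ∈ s, (monomial i (coeff i f) : X ⟶ Y) := by
    intro X Y f hf
    refine ⟨DFinsupp.support (β := fun i : ℤ => ((Φ ^ i).hom.obj X.obj ⟶ Y.obj)) f, ?_,
      (DirectSum.sum_support_of (β := fun i : ℤ => ((Φ ^ i).hom.obj X.obj ⟶ Y.obj)) f).symm⟩
    intro i hi
    by_contra h
    exact (DFinsupp.mem_support_iff.1 hi) (hf i (not_le.1 h))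
  obtain ⟨s, hs, ef⟩ := key hf
  obtain ⟨r, hr, eg⟩ := key hg
  rw [ef, eg, Preadditive.sum_comp]
  refine AddSubgroup.sum_mem _ fun i hi => ?_
  rw [Preadditive.comp_sum]
  refine AddSubgroup.sum_mem _ fun j hj => ?_
  have h := monomial_mem_nonneg (add_nonneg (hs i hi) (hr j hj))
    (coeffComp (coeff i f) (coeff j g))
  rw [← compHom_monomial] at h
  exact h

end TwistedLaurent

/-! ### The twisted polynomial category -/

/-- The objects of `A_Φ[t]`: those of `A`. -/
@[ext]
structure TwistedPolynomial {A : Type u} [Category.{v} A] [Preadditive A]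
    (Φ : AdditiveAutomorphism A) : Type u where
  obj : A

namespace TwistedPolynomial

variable {A : Type u} [Category.{v} A] [Preadditive A] {Φ : AdditiveAutomorphism A}

/-- `A_Φ[t]` is the subcategory of `A_Φ[t, t⁻¹]` with all objects and with the morphisms
`∑ i, f i • t ^ i` such that `f i = 0` for `i < 0`. -/
noncomputable instance : Category.{v} (TwistedPolynomial Φ) where
  Hom X Y := TwistedLaurent.nonneg (Φ := Φ) ⟨X.obj⟩ ⟨Y.obj⟩
  id X := ⟨𝟙 (⟨X.obj⟩ : TwistedLaurent Φ), TwistedLaurent.id_mem_nonneg _⟩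
  comp f g := ⟨f.1 ≫ g.1, TwistedLaurent.comp_mem_nonneg f.2 g.2⟩
  id_comp f := Subtype.ext (Category.id_comp f.1)
  comp_id f := Subtype.ext (Category.comp_id f.1)
  assoc f g h := Subtype.ext (Category.assoc f.1 g.1 h.1)

noncomputable instance : Preadditive (TwistedPolynomial Φ) where
  homGroup X Y := inferInstanceAs
    (AddCommGroup (TwistedLaurent.nonneg (Φ := Φ) ⟨X.obj⟩ ⟨Y.obj⟩))
  add_comp _ _ _ f f' g := Subtype.ext (Preadditive.add_comp _ _ _ f.1 f'.1 g.1)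
  comp_add _ _ _ f g g' := Subtype.ext (Preadditive.comp_add _ _ _ f.1 g.1 g'.1)

/-- The inclusion of `A` into `A_Φ[t]`, sending `f` to `f • t ^ 0`. -/
noncomputable def incl (Φ : AdditiveAutomorphism A) : A ⥤ TwistedPolynomial Φ where
  obj X := ⟨X⟩
  map {X Y} f := ⟨(TwistedLaurent.monomial 0 (eqToHom (Φ.zpow_zero_obj X) ≫ f) :
    TwistedLaurent.LHom Φ X Y), TwistedLaurent.monomial_mem_nonneg le_rfl _⟩
  map_id X := Subtype.ext (by rw [Category.comp_id]; rfl)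
  map_comp {X Y Z} f g := Subtype.ext (by
    refine Eq.trans ?_ (TwistedLaurent.compHom_monomial _ _).symm
    refine TwistedLaurent.monomial_congr (add_zero 0).symm _ _ ?_
    have := Functor.congr_hom Φ.zpow_zero_hom f
    simp [TwistedLaurent.coeffComp, this, eqToHom_map])

/-- The inclusion of `A_Φ[t]` into `A_Φ[t, t⁻¹]`. -/
noncomputable def toLaurent (Φ : AdditiveAutomorphism A) :
    TwistedPolynomial Φ ⥤ TwistedLaurent Φ where
  obj X := ⟨X.obj⟩
  map f := f.1

instance (Φ : AdditiveAutomorphism A) : (incl Φ).Additive where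
  map_add {X Y f g} := Subtype.ext (by
    refine Eq.trans ?_ (map_add (DirectSum.of (fun i : ℤ => ((Φ ^ i).hom.obj X ⟶ Y)) 0) _ _)
    simp only [incl, TwistedLaurent.monomial, Preadditive.comp_add])

instance (Φ : AdditiveAutomorphism A) : (toLaurent Φ).Additive where

/-- `A_Φ[t]` is again an additive category, with the direct sums of `A`. -/
instance [Limits.HasBinaryBiproducts A] : Limits.HasBinaryBiproducts (TwistedPolynomial Φ) where
  has_binary_biproduct X Y :=
    Limits.hasBinaryBiproduct_of_total
      ((incl Φ).mapBinaryBicone (Limits.BinaryBiproduct.bicone X.obj Y.obj)) (by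
        have h := congrArg (incl Φ).map (Limits.biprod.total (X := X.obj) (Y := Y.obj))
        rw [Functor.map_add, Functor.map_comp, Functor.map_comp] at h
        exact h.trans (CategoryTheory.Functor.map_id _ _))

/-- `A_Φ[t, t⁻¹]` is again an additive category, with the direct sums of `A`. -/
instance [Limits.HasBinaryBiproducts A] : Limits.HasBinaryBiproducts (TwistedLaurent Φ) where
  has_binary_biproduct X Y :=
    Limits.hasBinaryBiproduct_of_total
      ((incl Φ ⋙ toLaurent Φ).mapBinaryBicone (Limits.BinaryBiproduct.bicone X.obj Y.obj)) (by
        have h := congrArg (incl Φ ⋙ toLaurent Φ).map (Limits.biprod.total (X := X.obj) (Y := Y.obj))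
        rw [Functor.map_add, Functor.map_comp, Functor.map_comp] at h
        exact h.trans (CategoryTheory.Functor.map_id _ _))

end TwistedPolynomial

/-! ### Modules over a preadditive category and regularity -/

section Modules

variable (A : Type u) [Category.{v} A] [Preadditive A]

/-- `ℤA`-modules: contravariant additive functors from `A` to abelian groups. -/
abbrev PreaddModule := Aᵒᵖ ⥤+ AddCommGrpCat.{max u v}

end Modules

namespace PreaddModule

variable {A : Type u} [Category.{v} A] [Preadditive A]

/-- The abelian group `M(X)`. -/
abbrev val (M : PreaddModule A) (X : A) : AddCommGrpCat.{max u v} := M.obj.obj (op X)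

/-- The homomorphism `M(X) → N(X)` given by a morphism `M ⟶ N`. -/
abbrev app {M N : PreaddModule A} (f : M ⟶ N) (X : A) : M.val X →+ N.val X := (f.hom.app (op X)).hom

/-- For a finite family of elements `x j ∈ M(Z j)`, this is the value at the object `X` of the
homomorphism `⨁ j, mor_A(?, Z j) → M` that sends the identity of `Z j` to `x j`. -/
noncomputable def comb (M : PreaddModule A) {n : ℕ} {Z : Fin n → A} (x : ∀ j, M.val (Z j)) (X : A)
    (φ : ∀ j, X ⟶ Z j) : M.val X :=
  ∑ j, (M.obj.map (φ j).op).hom (x j)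

/-- `M` is a quotient of a finite direct sum of modules `mor_A(?, Z j)`. -/
def IsFinitelyGenerated (M : PreaddModule A) : Prop :=
  ∃ (n : ℕ) (Z : Fin n → A) (x : ∀ j, M.val (Z j)), ∀ X, Function.Surjective (M.comb x X)

/-- `M` is isomorphic to a finite direct sum of modules `mor_A(?, Z j)`. -/
def IsFinitelyGeneratedFree (M : PreaddModule A) : Prop :=
  ∃ (n : ℕ) (Z : Fin n → A) (x : ∀ j, M.val (Z j)), ∀ X, Function.Bijective (M.comb x X)

/-- Exactness of `M → N → P` at `N`, evaluated at all objects. -/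
def IsExact {M N P : PreaddModule A} (f : M ⟶ N) (g : N ⟶ P) : Prop :=
  ∀ X, Function.Exact (app f X) (app g X)

/-- There is an exact sequence `F₁ → F₀ → M → 0` with `F₁`, `F₀` finitely generated free. -/
def IsFinitelyPresented (M : PreaddModule A) : Prop :=
  ∃ (F₁ F₀ : PreaddModule A) (f : F₁ ⟶ F₀) (p : F₀ ⟶ M),
    F₁.IsFinitelyGeneratedFree ∧ F₀.IsFinitelyGeneratedFree ∧
      IsExact f p ∧ ∀ X, Function.Surjective (app p X)

/-- There is an exact sequence `0 → P l → ⋯ → P 1 → P 0 → M → 0` in which every `P i` is finitely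
generated projective. It is written as an infinite sequence with `P i = 0` for `i > l`. -/
def HasFiniteProjectiveResolution (M : PreaddModule A) (l : ℕ) : Prop :=
  ∃ (P : ℕ → PreaddModule A) (d : ∀ i, P (i + 1) ⟶ P i) (p : P 0 ⟶ M),
    (∀ i, (P i).IsFinitelyGenerated ∧ Projective (P i)) ∧
    (∀ i, l < i → ∀ X, Subsingleton ((P i).val X)) ∧
    (∀ i, IsExact (d (i + 1)) (d i)) ∧ IsExact (d 0) p ∧ ∀ X, Function.Surjective (app p X)

/-- `M` is of type `FP`. -/
def IsTypeFP (M : PreaddModule A) : Prop := ∃ n, M.HasFiniteProjectiveResolution n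

end PreaddModule

section Regularity

variable (A : Type u) [Category.{v} A] [Preadditive A]

/-- Every submodule of a finitely generated `ℤA`-module is finitely generated. -/
def IsNoetherianCat : Prop :=
  ∀ (M N : PreaddModule A) (f : N ⟶ M), (∀ X, Function.Injective (PreaddModule.app f X)) →
    M.IsFinitelyGenerated → N.IsFinitelyGenerated

/-- Every finitely presented `ℤA`-module is of type `FP`. -/
def IsRegularCoherentCat : Prop :=
  ∀ M : PreaddModule A, M.IsFinitelyPresented → M.IsTypeFP

/-- Every finitely presented `ℤA`-module has an `l`-dimensional finite projective resolution. -/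
def IsUniformlyRegularCoherentCat (l : ℕ) : Prop :=
  ∀ M : PreaddModule A, M.IsFinitelyPresented → M.HasFiniteProjectiveResolution l

/-- `A` is regular: Noetherian and regular coherent. -/
def IsRegularCat : Prop := IsNoetherianCat A ∧ IsRegularCoherentCat A

/-- `A` is `l`-uniformly regular: Noetherian and `l`-uniformly regular coherent. -/
def IsUniformlyRegularCat (l : ℕ) : Prop := IsNoetherianCat A ∧ IsUniformlyRegularCoherentCat A l

end Regularity

/-! Everything is reduced to statements about single morphisms. When there is an object and binary
biproducts exist, a finitely generated module has one generator, hence is a quotient of some `mor(?,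
Z)`. So Noetherian means that every right ideal is generated by one morphism
(`isNoetherianCat_iff`), and the finitely presented modules are then the cokernels of single
morphisms `a`. Their projective dimension is read off by passing to weak kernels
(`IsWeakKernel.cokerPdLE_succ_iff`) until the equation `a ≫ r ≫ a = a` holds, which says that the
cokernel is projective (`cokerPdLE_zero_iff`). Hence an additive functor that preserves weak kernels
preserves bounds on projective dimension (`CokerPdLE.map`). Both inclusions `A → A_Φ[t] → A_Φ[t,
t⁻¹]` are of this kind.

From `A` to `A_Φ[t]`, Noetherianity is Hilbert's basis theorem (`PolyIdeal.exists_generator`): the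
ideals of leading coefficients increase with the degree, and the generator of their union already
occurs in some degree `n`. For the dimension bound (`exists_cokerPdLE`), let `K` be the image of
`d`, generated by its part `K_{≤n}` of degree at most `n`. There is a short exact sequence `0 →
A_Φ[t] ⊗ K_{<n} → A_Φ[t] ⊗ K_{≤n} → K → 0`, with `K_{<n}` twisted by `Φ`, whose first map is the
difference of "multiply by `t` inside `K`" and "multiply by `t` outside". Both parts are finitely
presented over `A`, so `K` costs one extra dimension and the cokernel of `d` another.

From `A_Φ[t]` to `A_Φ[t, t⁻¹]`, the powers of `t` become isomorphisms, and every Laurent morphism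
becomes polynomial after precomposition with one of them (`exists_fraction`). Ideals, weak kernels
and images are therefore all extended from `A_Φ[t]`, with no loss of dimension. -/

/-! ### The abelian category of additive functors. -/

section AdditiveFunctorsAbelian

variable {C : Type*} [Category* C] [Preadditive C] {D : Type*} [Category* D] [Abelian D]

/-- Additivity is an equation between morphisms into `F.obj Y`, so it can be tested after a jointly
monic family into additive functors. Subfunctors and products are both of this kind. -/
theorem additive_of_mono_family {J : Type*} {F : C ⥤ D} {G : J → C ⥤ D} [∀ j, (G j).Additive]
    (α : ∀ j, F ⟶ G j)
    (h : ∀ (X : C) (W : D) (p q : W ⟶ F.obj X), (∀ j, p ≫ (α j).app X = q ≫ (α j).app X) → p = q) :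
    F.Additive where
  map_add {X Y f g} := h _ _ _ _ fun j => by
    simp [Preadditive.add_comp, (G j).map_add, Preadditive.comp_add]

theorem additive_of_epi {F G : C ⥤ D} [F.Additive] (α : F ⟶ G) [Epi α] : G.Additive where
  map_add {X Y f g} := by
    rw [← cancel_epi (α.app X)]
    simp [Preadditive.comp_add, ← NatTrans.naturality, F.map_add, Preadditive.add_comp]

instance : (additiveFunctor C D).ContainsZero where
  exists_zero := ⟨_, Limits.isZero_zero _, Functor.Additive.of_isZero (Limits.isZero_zero _)⟩

instance : (additiveFunctor C D).IsClosedUnderKernels where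
  kernels_le := by
    rintro _ ⟨f, k, hk, hf⟩
    have : Functor.Additive _ := hf.1
    have : Mono k.ι := Limits.mono_of_isLimit_fork hk
    exact additive_of_mono_family (J := Unit) (fun _ => k.ι) fun X W p q h =>
      (cancel_mono (k.ι.app X)).1 (h ())

instance : (additiveFunctor C D).IsClosedUnderCokernels where
  cokernels_le := by
    rintro _ ⟨f, k, hk, hf⟩
    have : Functor.Additive _ := hf.2
    have : Epi k.π := Limits.epi_of_isColimit_cofork hk
    exact additive_of_epi k.π

instance : (additiveFunctor C D).IsClosedUnderFiniteProducts where
  isClosedUnderLimitsOfShape J _ := ⟨by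
    rintro F ⟨h⟩
    have (j : J) : Functor.Additive _ := h.prop_diag_obj ⟨j⟩
    refine additive_of_mono_family (J := J) (fun j => h.π.app ⟨j⟩) fun X W p q hpq => ?_
    refine (Limits.isLimitOfPreserves ((evaluation C D).obj X) h.isLimit).hom_ext ?_
    rintro ⟨j⟩
    exact hpq j⟩

noncomputable instance : Abelian (C ⥤+ D) := inferInstanceAs (Abelian (additiveFunctor C D).FullSubcategory)

end AdditiveFunctorsAbelian

/-! ### Modules handled through elements: restriction, submodules, quotients, exactness. -/

namespace PreaddModule

variable {B : Type u} [Category.{v} B] [Preadditive B]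

/-- The restriction `M(Y) → M(X)` along a morphism `X ⟶ Y`. -/
def res (M : PreaddModule B) {X Y : B} (f : X ⟶ Y) : M.val Y →+ M.val X := (M.obj.map f.op).hom

@[simp] theorem res_id (M : PreaddModule B) {X : B} (m : M.val X) : M.res (𝟙 X) m = m := by
  simp [res]

@[simp] theorem res_comp (M : PreaddModule B) {X Y Z : B} (f : X ⟶ Y) (g : Y ⟶ Z) (m : M.val Z) :
    M.res (f ≫ g) m = M.res f (M.res g m) := by
  simp [res]

@[simp] theorem res_add (M : PreaddModule B) {X Y : B} (f g : X ⟶ Y) (m : M.val Y) :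
    M.res (f + g) m = M.res f m + M.res g m := by
  simp [res, M.obj.map_add]

@[simp] theorem res_zero (M : PreaddModule B) {X Y : B} (m : M.val Y) :
    M.res (0 : X ⟶ Y) m = 0 := by
  simp [res, M.obj.map_zero]

@[simp] theorem res_neg (M : PreaddModule B) {X Y : B} (f : X ⟶ Y) (m : M.val Y) :
    M.res (-f) m = -M.res f m := by
  simp [res, M.obj.map_neg]

@[simp] theorem res_sub (M : PreaddModule B) {X Y : B} (f g : X ⟶ Y) (m : M.val Y) :
    M.res (f - g) m = M.res f m - M.res g m := by
  simp [sub_eq_add_neg]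

theorem app_res {M N : PreaddModule B} (α : M ⟶ N) {X Y : B} (f : X ⟶ Y) (m : M.val Y) :
    app α X (M.res f m) = N.res f (app α Y m) :=
  DFunLike.congr_fun (congrArg AddCommGrpCat.Hom.hom (α.hom.naturality f.op)) m

@[simp] theorem app_comp {M N P : PreaddModule B} (α : M ⟶ N) (β : N ⟶ P) (X : B) (m : M.val X) :
    app (α ≫ β) X m = app β X (app α X m) := rfl

@[simp] theorem app_id (M : PreaddModule B) (X : B) (m : M.val X) : app (𝟙 M) X m = m := rfl

@[simp] theorem app_zero (M N : PreaddModule B) (X : B) (m : M.val X) : app (0 : M ⟶ N) X m = 0 := rfl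

theorem hom_ext {M N : PreaddModule B} {α β : M ⟶ N} (h : ∀ X m, app α X m = app β X m) : α = β := by
  apply ObjectProperty.hom_ext
  ext X m
  exact h X.unop m

/-- A module morphism from a natural family of homomorphisms. -/
def homMk {M N : PreaddModule B} (f : ∀ X, M.val X →+ N.val X)
    (hf : ∀ {X Y : B} (φ : X ⟶ Y) (m : M.val Y), f X (M.res φ m) = N.res φ (f Y m)) : M ⟶ N :=
  ObjectProperty.homMk
    { app := fun X => AddCommGrpCat.ofHom (f X.unop)
      naturality := fun X Y φ => by
        ext m
        exact hf φ.unop m }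

@[simp] theorem app_homMk {M N : PreaddModule B} (f : ∀ X, M.val X →+ N.val X) (hf) (X : B)
    (m : M.val X) : app (homMk (M := M) (N := N) f hf) X m = f X m := rfl

/-- A module from its values and restriction maps. -/
def ofRes (V : B → Type max u v) [∀ X, AddCommGroup (V X)] (r : ∀ {X Y : B}, (X ⟶ Y) → (V Y →+ V X))
    (r_id : ∀ X (m : V X), r (𝟙 X) m = m)
    (r_comp : ∀ {X Y Z : B} (f : X ⟶ Y) (g : Y ⟶ Z) (m : V Z), r (f ≫ g) m = r f (r g m))
    (r_add : ∀ {X Y : B} (f g : X ⟶ Y) (m : V Y), r (f + g) m = r f m + r g m) :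
    PreaddModule B where
  obj :=
    { obj := fun X => AddCommGrpCat.of (V X.unop)
      map := fun f => AddCommGrpCat.ofHom (r f.unop)
      map_id := fun X => by ext m; exact r_id _ m
      map_comp := fun f g => by ext m; exact r_comp _ _ m }
  property := ⟨fun {X Y f g} => by ext m; exact r_add _ _ m⟩

/-- A submodule of `M`. -/
structure Sub (M : PreaddModule B) where
  carrier : ∀ X, AddSubgroup (M.val X)
  res_mem : ∀ {X Y : B} (f : X ⟶ Y) {m}, m ∈ carrier Y → M.res f m ∈ carrier X

namespace Sub

variable {M : PreaddModule B} (S : Sub M)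

/-- A submodule as a module. -/
def toModule : PreaddModule B :=
  ofRes (fun X => S.carrier X)
    (fun {X Y} f => ((M.res f).comp (S.carrier Y).subtype).codRestrict (S.carrier X)
      fun m => S.res_mem f m.2)
    (fun _ _ => Subtype.ext (M.res_id _))
    (fun f g _ => Subtype.ext (M.res_comp f g _))
    (fun f g _ => Subtype.ext (M.res_add f g _))

/-- The inclusion of a submodule. -/
def incl : S.toModule ⟶ M := homMk (fun X => (S.carrier X).subtype) fun _ _ => rfl

theorem incl_injective (X : B) : Function.Injective (app S.incl X) := Subtype.val_injective

theorem exists_incl_eq_iff {X : B} (m : M.val X) : (∃ s, app S.incl X s = m) ↔ m ∈ S.carrier X :=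
  ⟨fun ⟨s, hs⟩ => hs ▸ s.2, fun h => ⟨⟨m, h⟩, rfl⟩⟩

/-- The quotient of a module by a submodule. -/
def quot : PreaddModule B :=
  ofRes (fun X => M.val X ⧸ S.carrier X)
    (fun {X Y} f => QuotientAddGroup.map _ _ (M.res f) fun m hm => S.res_mem f hm)
    (fun _ m => by
      induction m using QuotientAddGroup.induction_on with
      | H m => exact congrArg QuotientAddGroup.mk (M.res_id m))
    (fun f g m => by
      induction m using QuotientAddGroup.induction_on with
      | H m => exact congrArg QuotientAddGroup.mk (M.res_comp f g m))
    (fun f g m => by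
      induction m using QuotientAddGroup.induction_on with
      | H m => exact congrArg QuotientAddGroup.mk (M.res_add f g m))

/-- The projection to a quotient module. -/
def proj : M ⟶ S.quot := homMk (fun X => QuotientAddGroup.mk' (S.carrier X)) fun _ _ => rfl

theorem proj_surjective (X : B) : Function.Surjective (app S.proj X) :=
  QuotientAddGroup.mk'_surjective _

theorem proj_eq_zero_iff {X : B} (m : M.val X) : app S.proj X m = 0 ↔ m ∈ S.carrier X :=
  QuotientAddGroup.eq_zero_iff m

/-- The kernel of a module morphism. -/
def ker {M N : PreaddModule B} (α : M ⟶ N) : Sub M where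
  carrier X := (app α X).ker
  res_mem f m hm := by
    rw [AddMonoidHom.mem_ker] at hm ⊢
    rw [app_res, hm, map_zero]

end Sub

theorem mono_of_injective {M N : PreaddModule B} (α : M ⟶ N)
    (h : ∀ X, Function.Injective (app α X)) : Mono α where
  right_cancellation β γ e := hom_ext fun X m => h X (by rw [← app_comp, e, app_comp])

theorem epi_of_surjective {M N : PreaddModule B} (α : M ⟶ N)
    (h : ∀ X, Function.Surjective (app α X)) : Epi α where
  left_cancellation β γ e := hom_ext fun X m => by
    obtain ⟨m, rfl⟩ := h X m
    rw [← app_comp, e, app_comp]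

/-- The inclusion into all functors preserves epimorphisms, and there they are detected objectwise.
This links the categorical notion of projectivity with objectwise surjectivity. -/
theorem surjective_of_epi {M N : PreaddModule B} (α : M ⟶ N) [Epi α] (X : B) :
    Function.Surjective (app α X) := by
  have := ObjectProperty.preservesEpimorphisms_ι_of_isNormalMonoCategory
    (additiveFunctor Bᵒᵖ AddCommGrpCat.{max u v})
  have h : Epi ((additiveFunctor Bᵒᵖ AddCommGrpCat.{max u v}).ι.map α) := inferInstance
  rw [NatTrans.epi_iff_epi_app] at h
  exact (AddCommGrpCat.epi_iff_surjective _).1 (h (op X))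

/-- Lifting of a morphism along an injective one. -/
theorem exists_lift {M N P : PreaddModule B} (α : M ⟶ N) (h : ∀ X, Function.Injective (app α X))
    (β : P ⟶ N) (hβ : ∀ X p, ∃ m, app α X m = app β X p) : ∃ γ : P ⟶ M, γ ≫ α = β := by
  choose f hf using hβ
  refine ⟨homMk (fun X => AddMonoidHom.mk' (f X) fun p q => h X ?_) fun φ p => h _ ?_, ?_⟩
  · simp only [map_add, hf]
  · simp only [AddMonoidHom.mk'_apply, hf, app_res]
  · exact hom_ext fun X p => hf X p

/-- Objectwise short exactness implies short exactness in the abelian category of modules. -/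
theorem shortExact {M N P : PreaddModule B} (α : M ⟶ N) (β : N ⟶ P)
    (hα : ∀ X, Function.Injective (app α X)) (hβ : ∀ X, Function.Surjective (app β X))
    (h : IsExact α β) : ∃ w : α ≫ β = 0, (ShortComplex.mk α β w).ShortExact := by
  have w : α ≫ β = 0 := hom_ext fun X m => (h X _).2 ⟨m, rfl⟩
  have := mono_of_injective α hα
  have := epi_of_surjective β hβ
  have key : ∀ {T : PreaddModule B} (γ : T ⟶ N), γ ≫ β = 0 → ∃ δ : T ⟶ M, δ ≫ α = γ := by
    intro T γ hγ
    refine exists_lift α hα γ fun X t => (h X _).1 ?_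
    rw [← app_comp, hγ, app_zero]
  refine ⟨w, { exact := ShortComplex.exact_of_f_is_kernel _ ?_ }⟩
  exact Limits.KernelFork.IsLimit.ofι _ _ (fun γ hγ => (key γ hγ).choose)
    (fun γ hγ => (key γ hγ).choose_spec) fun γ hγ m hm => by
      rw [← cancel_mono α]
      exact hm.trans (key γ hγ).choose_spec.symm

end PreaddModule

/-! ### Free modules and cokernels of single morphisms. -/

namespace PreaddModule

variable {B : Type u} [Category.{v} B] [Preadditive B]

/-- The free module `mor_B(?, Z)`. -/
def free (Z : B) : PreaddModule B :=
  ofRes (fun X => ULift.{u} (X ⟶ Z))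
    (fun f => AddMonoidHom.mk' (fun g => ⟨f ≫ g.down⟩) fun _ _ =>
      congrArg ULift.up (Preadditive.comp_add _ _ _ _ _ _))
    (fun _ _ => congrArg ULift.up (Category.id_comp _))
    (fun _ _ _ => congrArg ULift.up (Category.assoc _ _ _))
    (fun _ _ _ => congrArg ULift.up (Preadditive.add_comp _ _ _ _ _ _))

/-- The element of `mor_B(X, Z)` given by a morphism. -/
def toFree {X Z : B} : (X ⟶ Z) →+ (free Z).val X := AddMonoidHom.mk' (fun f => ⟨f⟩) fun _ _ => rfl

theorem toFree_injective {X Z : B} : Function.Injective (toFree (X := X) (Z := Z)) :=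
  fun _ _ h => congrArg ULift.down h

theorem toFree_surjective {X Z : B} : Function.Surjective (toFree (X := X) (Z := Z)) :=
  fun x => ⟨ULift.down x, rfl⟩

@[simp] theorem res_toFree {W X Z : B} (f : W ⟶ X) (g : X ⟶ Z) :
    (free Z).res f (toFree g) = toFree (f ≫ g) := rfl

/-- The element `z ∈ M(Z)` generates `M`. -/
def IsGenerator (M : PreaddModule B) {Z : B} (z : M.val Z) : Prop :=
  ∀ (X : B) (m : M.val X), ∃ φ : X ⟶ Z, M.res φ z = m

/-- The element `z ∈ M(Z)` identifies `M` with the cokernel of `mor(?, Y) → mor(?, Z)` given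
by `a : Y ⟶ Z`. -/
structure IsPresentation (M : PreaddModule B) {Y Z : B} (z : M.val Z) (a : Y ⟶ Z) : Prop where
  gen : M.IsGenerator z
  rel : ∀ {X : B} (φ : X ⟶ Z), M.res φ z = 0 ↔ ∃ χ : X ⟶ Y, χ ≫ a = φ

theorem IsPresentation.res_eq_zero {M : PreaddModule B} {Y Z : B} {z : M.val Z} {a : Y ⟶ Z}
    (h : M.IsPresentation z a) : M.res a z = 0 :=
  (h.rel a).2 ⟨𝟙 Y, Category.id_comp a⟩

/-- The universal property of the cokernel. Two expressions of the same element of `M` differ by a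
multiple of `a`, which annihilates `n`. -/
theorem IsPresentation.exists_hom {M N : PreaddModule B} {Y Z : B} {z : M.val Z} {a : Y ⟶ Z}
    (h : M.IsPresentation z a) (n : N.val Z) (hn : N.res a n = 0) : ∃ α : M ⟶ N, app α Z z = n := by
  have key : ∀ {X} (φ ψ : X ⟶ Z), M.res φ z = M.res ψ z → N.res φ n = N.res ψ n := by
    intro X φ ψ e
    obtain ⟨χ, hχ⟩ := (h.rel (φ - ψ)).1 (by rw [res_sub, e, sub_self])
    rw [← sub_eq_zero, ← res_sub, ← hχ, res_comp, hn, map_zero]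
  choose f hf using h.gen
  refine ⟨homMk (fun X => AddMonoidHom.mk' (fun m => N.res (f X m) n) fun m m' => ?_)
    fun φ m => ?_, ?_⟩
  · rw [← res_add]
    exact key _ _ (by rw [res_add, hf, hf, hf])
  · simp only [AddMonoidHom.mk'_apply]
    rw [← res_comp]
    exact key _ _ (by rw [res_comp, hf, hf])
  · simp only [app_homMk, AddMonoidHom.mk'_apply]
    exact (key _ (𝟙 Z) (by rw [hf, res_id])).trans (res_id _ _)

theorem IsGenerator.hom_ext {M N : PreaddModule B} {Z : B} {z : M.val Z} (h : M.IsGenerator z)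
    {α β : M ⟶ N} (e : app α Z z = app β Z z) : α = β :=
  PreaddModule.hom_ext fun X m => by
    obtain ⟨φ, rfl⟩ := h X m
    rw [app_res, app_res, e]

theorem free_isGenerator (Z : B) : (free Z).IsGenerator (toFree (𝟙 Z)) := fun X m => by
  obtain ⟨φ, rfl⟩ := toFree_surjective m
  exact ⟨φ, by rw [res_toFree, Category.comp_id]⟩

/-- The homomorphism `mor(?, Z) → M` given by an element of `M(Z)`. -/
def freeLift {M : PreaddModule B} {Z : B} (z : M.val Z) : free Z ⟶ M :=
  homMk (fun _ => AddMonoidHom.mk' (fun φ => M.res (ULift.down φ) z) fun φ ψ =>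
    M.res_add (ULift.down φ) (ULift.down ψ) z)
    fun φ ψ => M.res_comp φ (ULift.down ψ) z

@[simp] theorem freeLift_toFree {M : PreaddModule B} {X Z : B} (z : M.val Z) (φ : X ⟶ Z) :
    app (freeLift z) X (toFree φ) = M.res φ z := rfl

theorem IsGenerator.freeLift_surjective {M : PreaddModule B} {Z : B} {z : M.val Z}
    (h : M.IsGenerator z) (X : B) : Function.Surjective (app (freeLift z) X) := fun m => by
  obtain ⟨φ, rfl⟩ := h X m
  exact ⟨toFree φ, rfl⟩

instance (Z : B) : Projective (free Z) where
  factors {E M} f e _ := by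
    obtain ⟨x, hx⟩ := surjective_of_epi e Z (app f Z (toFree (𝟙 Z)))
    refine ⟨freeLift x, (free_isGenerator Z).hom_ext ?_⟩
    rw [app_comp, freeLift_toFree, res_id, hx]

theorem exists_isPresentation {Y Z : B} (a : Y ⟶ Z) :
    ∃ (M : PreaddModule B) (z : M.val Z), M.IsPresentation z a := by
  let S : Sub (free Z) :=
    { carrier := fun X => (app (freeLift (toFree a)) X).range
      res_mem := by
        rintro W X f _ ⟨m, rfl⟩
        exact ⟨(free Y).res f m, app_res _ _ _⟩ }
  have key : ∀ {X} (φ : X ⟶ Z),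
      S.quot.res φ (app S.proj Z (toFree (𝟙 Z))) = app S.proj X (toFree φ) := fun φ => by
    rw [← app_res, res_toFree, Category.comp_id]
  refine ⟨S.quot, app S.proj Z (toFree (𝟙 Z)), fun X m => ?_, fun {X} φ => ?_⟩
  · obtain ⟨m, rfl⟩ := S.proj_surjective X m
    obtain ⟨φ, rfl⟩ := toFree_surjective m
    exact ⟨φ, key φ⟩
  · rw [key, Sub.proj_eq_zero_iff]
    constructor
    · rintro ⟨m, hm⟩
      obtain ⟨χ, rfl⟩ := toFree_surjective m
      exact ⟨χ, toFree_injective hm⟩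
    · rintro ⟨χ, rfl⟩
      exact ⟨toFree χ, rfl⟩

theorem IsPresentation.nonempty_iso {M N : PreaddModule B} {Y Z : B} {z : M.val Z} {n : N.val Z}
    {a : Y ⟶ Z} (h : M.IsPresentation z a) (h' : N.IsPresentation n a) : Nonempty (M ≅ N) := by
  obtain ⟨α, hα⟩ := h.exists_hom n h'.res_eq_zero
  obtain ⟨β, hβ⟩ := h'.exists_hom z h.res_eq_zero
  exact ⟨α, β, h.gen.hom_ext (by rw [app_comp, hα, hβ, app_id]),
    h'.gen.hom_ext (by rw [app_comp, hβ, hα, app_id])⟩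

/-- A section of `mor(?, Z) → M` is given by an endomorphism `e` of `Z` with `a ≫ e = 0` and `𝟙 - e
= r ≫ a`. Conversely `𝟙 - r ≫ a` kills `a` and descends to a section. Projectivity thus becomes an
equation that any functor preserves. -/
theorem IsPresentation.projective_iff {M : PreaddModule B} {Y Z : B} {z : M.val Z} {a : Y ⟶ Z}
    (h : M.IsPresentation z a) : Projective M ↔ ∃ r : Z ⟶ Y, a ≫ r ≫ a = a := by
  constructor
  · intro _
    have := epi_of_surjective (freeLift z) h.gen.freeLift_surjective
    have hs := Projective.factorThru_comp (𝟙 M) (freeLift z)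
    obtain ⟨e, he⟩ := toFree_surjective (app (Projective.factorThru (𝟙 M) (freeLift z)) Z z)
    have hez : M.res e z = z := by
      rw [← freeLift_toFree, he, ← app_comp, hs, app_id]
    have hae : a ≫ e = 0 := by
      apply toFree_injective
      rw [← res_toFree, he, ← app_res, h.res_eq_zero, map_zero, map_zero]
    obtain ⟨r, hr⟩ := (h.rel (𝟙 Z - e)).1 (by rw [res_sub, hez, res_id, sub_self])
    exact ⟨r, by rw [hr, Preadditive.comp_sub, hae, Category.comp_id, sub_zero]⟩
  · rintro ⟨r, hr⟩
    obtain ⟨s, hs⟩ := h.exists_hom (N := free Z) (toFree (𝟙 Z - r ≫ a)) (by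
      rw [res_toFree, Preadditive.comp_sub, hr, Category.comp_id, sub_self, map_zero])
    have hsp : s ≫ freeLift z = 𝟙 M := h.gen.hom_ext (by
      rw [app_comp, hs, freeLift_toFree, res_sub, res_id, app_id, res_comp, h.res_eq_zero,
        map_zero, sub_zero])
    exact (Retract.mk s (freeLift z) hsp).projective

end PreaddModule

open PreaddModule

/-! ### Projective dimension of cokernels. -/

section ProjectiveDimension

variable {B : Type u} [Category.{v} B] [Preadditive B]

/-- The modules presented by `a` have projective dimension at most `n`. -/
def CokerPdLE (n : ℕ) {Y Z : B} (a : Y ⟶ Z) : Prop :=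
  ∀ (M : PreaddModule B) (z : M.val Z), M.IsPresentation z a → HasProjectiveDimensionLE M n

theorem PreaddModule.IsPresentation.cokerPdLE_iff {M : PreaddModule B} {Y Z : B} {z : M.val Z}
    {a : Y ⟶ Z} (h : M.IsPresentation z a) {n : ℕ} :
    CokerPdLE n a ↔ HasProjectiveDimensionLE M n := by
  refine ⟨fun H => H M z h, fun H N z' h' => ?_⟩
  obtain ⟨e⟩ := h.nonempty_iso h'
  exact hasProjectiveDimensionLT_of_iso e _

/-- The morphism `k` is a weak kernel of `a`. -/
def IsWeakKernel {W Y Z : B} (k : W ⟶ Y) (a : Y ⟶ Z) : Prop :=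
  ∀ (X : B) (ψ : X ⟶ Y), ψ ≫ a = 0 ↔ ∃ χ : X ⟶ W, χ ≫ k = ψ

theorem IsWeakKernel.comp_eq_zero {W Y Z : B} {k : W ⟶ Y} {a : Y ⟶ Z} (h : IsWeakKernel k a) :
    k ≫ a = 0 :=
  (h _ k).2 ⟨𝟙 W, Category.id_comp k⟩

theorem CokerPdLE.mono {n m : ℕ} (h : n ≤ m) {Y Z : B} {a : Y ⟶ Z} (H : CokerPdLE n a) :
    CokerPdLE m a := fun M z hM => by
  have := H M z hM
  exact hasProjectiveDimensionLT_of_ge M (n + 1) (m + 1) (by omega)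

/-- The cokernel depends only on the image of `a` in `mor(?, Z)`, so generators of an ideal may be
exchanged. -/
theorem CokerPdLE.of_factors {n : ℕ} {Y Y' Z : B} {a : Y ⟶ Z} {a' : Y' ⟶ Z}
    (h : ∀ {X : B} (φ : X ⟶ Z), (∃ χ, χ ≫ a = φ) ↔ ∃ χ, χ ≫ a' = φ) (H : CokerPdLE n a) :
    CokerPdLE n a' :=
  fun M z hM => H M z ⟨hM.gen, fun φ => (hM.rel φ).trans (h φ).symm⟩

theorem cokerPdLE_zero_iff {Y Z : B} (a : Y ⟶ Z) :
    CokerPdLE 0 a ↔ ∃ r : Z ⟶ Y, a ≫ r ≫ a = a := by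
  obtain ⟨M, z, h⟩ := exists_isPresentation a
  rw [h.cokerPdLE_iff, ← h.projective_iff, projective_iff_hasProjectiveDimensionLE_zero]

/-- The cokernel of `k` is the image of `a`, that is, the first syzygy of the cokernel of `a` inside
the projective module `mor(?, Z)`; dimension shifting applies. -/
theorem IsWeakKernel.cokerPdLE_succ_iff {W Y Z : B} {k : W ⟶ Y} {a : Y ⟶ Z}
    (hk : IsWeakKernel k a) (n : ℕ) : CokerPdLE (n + 1) a ↔ CokerPdLE n k := by
  obtain ⟨M, z, h⟩ := exists_isPresentation a
  obtain ⟨K, y, h'⟩ := exists_isPresentation k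
  rw [h.cokerPdLE_iff, h'.cokerPdLE_iff]
  obtain ⟨α, hα⟩ := h'.exists_hom (N := free Z) (toFree a) (by
    rw [res_toFree, hk.comp_eq_zero, map_zero])
  have hα' : ∀ {X} (φ : X ⟶ Y), app α X (K.res φ y) = toFree (φ ≫ a) := fun φ => by
    rw [app_res, hα, res_toFree]
  obtain ⟨w, S⟩ := shortExact α (freeLift z) (fun X => by
      rw [injective_iff_map_eq_zero]
      intro m hm
      obtain ⟨φ, rfl⟩ := h'.gen X m
      rw [hα', ← map_zero toFree] at hm
      exact (h'.rel φ).2 ((hk _ φ).1 (toFree_injective hm)))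
    h.gen.freeLift_surjective (fun X m => by
      obtain ⟨φ, rfl⟩ := toFree_surjective m
      rw [freeLift_toFree, h.rel]
      constructor
      · rintro ⟨χ, rfl⟩
        exact ⟨K.res χ y, hα' χ⟩
      · rintro ⟨m, hm⟩
        obtain ⟨χ, rfl⟩ := h'.gen X m
        rw [hα'] at hm
        exact ⟨χ, toFree_injective hm⟩)
  exact S.hasProjectiveDimensionLT_X₃_iff n (inferInstanceAs (Projective (free Z)))

/-- If the cokernels of `b`, `a`, `c` form a short exact sequence whose first map is induced
by `τ`, the projective dimension of the last one is bounded. -/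
theorem CokerPdLE.of_shortExact {n : ℕ} {V₁ V₀ Z₁ Z₀ W : B} {b : V₁ ⟶ V₀} {a : Z₁ ⟶ Z₀}
    {τ : V₀ ⟶ Z₀} {c : W ⟶ Z₀}
    (hb : ∀ {X : B} (ψ : X ⟶ V₀), (∃ χ, χ ≫ a = ψ ≫ τ) ↔ ∃ χ, χ ≫ b = ψ)
    (hc : ∀ {X : B} (φ : X ⟶ Z₀), (∃ χ, χ ≫ c = φ) ↔ ∃ ψ χ, χ ≫ a = φ - ψ ≫ τ)
    (Hb : CokerPdLE n b) (Ha : CokerPdLE (n + 1) a) : CokerPdLE (n + 1) c := by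
  obtain ⟨M, z, h⟩ := exists_isPresentation a
  obtain ⟨K, y, h'⟩ := exists_isPresentation b
  obtain ⟨N, x, h''⟩ := exists_isPresentation c
  rw [h''.cokerPdLE_iff]
  rw [h.cokerPdLE_iff] at Ha
  rw [h'.cokerPdLE_iff] at Hb
  obtain ⟨α, hα⟩ := h'.exists_hom (N := M) (M.res τ z) (by
    rw [← res_comp, h.rel, hb]
    exact ⟨𝟙 _, Category.id_comp _⟩)
  obtain ⟨β, hβ⟩ := h.exists_hom (N := N) x (by
    rw [h''.rel, hc]
    exact ⟨0, 𝟙 _, by rw [Limits.zero_comp, sub_zero, Category.id_comp]⟩)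
  have hα' : ∀ {X} (φ : X ⟶ V₀), app α X (K.res φ y) = M.res (φ ≫ τ) z := fun φ => by
    rw [app_res, hα, res_comp]
  have hβ' : ∀ {X} (φ : X ⟶ Z₀), app β X (M.res φ z) = N.res φ x := fun φ => by
    rw [app_res, hβ]
  obtain ⟨w, S⟩ := shortExact α β (fun X => by
      rw [injective_iff_map_eq_zero]
      intro m hm
      obtain ⟨φ, rfl⟩ := h'.gen X m
      rw [hα', h.rel, hb] at hm
      exact (h'.rel φ).2 hm)
    (fun X m => by
      obtain ⟨φ, rfl⟩ := h''.gen X m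
      exact ⟨M.res φ z, hβ' φ⟩) (fun X m => by
      obtain ⟨φ, rfl⟩ := h.gen X m
      rw [hβ', h''.rel, hc]
      constructor
      · rintro ⟨ψ, hψ⟩
        rw [← h.rel, res_sub, sub_eq_zero] at hψ
        exact ⟨K.res ψ y, (hα' ψ).trans hψ.symm⟩
      · rintro ⟨m, hm⟩
        obtain ⟨ψ, rfl⟩ := h'.gen X m
        rw [hα'] at hm
        exact ⟨ψ, (h.rel _).1 (by rw [res_sub, hm, sub_self])⟩)
  exact S.hasProjectiveDimensionLT_X₃ (n + 1) Hb Ha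

/-- The bound unwinds to `n` successive weak kernels followed by the splitting equation `a ≫ r ≫ a =
a`. The hypothesis on `F`, a form of flatness, preserves the former, and functoriality the latter.
-/
theorem CokerPdLE.map {A : Type*} [Category* A] [Preadditive A] (F : A ⥤ B)
    (hA : ∀ {Y Z : A} (a : Y ⟶ Z), ∃ (W : A) (k : W ⟶ Y), IsWeakKernel k a)
    (hF : ∀ {W Y Z : A} (k : W ⟶ Y) (a : Y ⟶ Z), IsWeakKernel k a →
      IsWeakKernel (F.map k) (F.map a))
    {n : ℕ} {Y Z : A} {a : Y ⟶ Z} (H : CokerPdLE n a) : CokerPdLE n (F.map a) := by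
  induction n generalizing Y Z with
  | zero =>
    rw [cokerPdLE_zero_iff] at H ⊢
    obtain ⟨r, hr⟩ := H
    exact ⟨F.map r, by rw [← F.map_comp, ← F.map_comp, hr]⟩
  | succ n ih =>
    obtain ⟨W, k, hk⟩ := hA a
    rw [hk.cokerPdLE_succ_iff] at H
    exact ((hF k a hk).cokerPdLE_succ_iff n).2 (ih H)

end ProjectiveDimension

open PreaddModule

/-! ### The Noetherian condition in terms of right ideals. -/

section Noetherian

variable {B : Type u} [Category.{v} B] [Preadditive B]

/-- Every right ideal of `B` is generated by a single morphism. -/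
def HasPrincipalIdeals (B : Type u) [Category.{v} B] [Preadditive B] : Prop :=
  ∀ (Z : B) (S : ∀ X, AddSubgroup (X ⟶ Z)),
    (∀ (X Y : B) (f : X ⟶ Y) (g : Y ⟶ Z), g ∈ S Y → f ≫ g ∈ S X) →
      ∃ (Y : B) (a : Y ⟶ Z), ∀ (X : B) (φ : X ⟶ Z), φ ∈ S X ↔ ∃ χ : X ⟶ Y, χ ≫ a = φ

theorem PreaddModule.IsGenerator.isFinitelyGenerated {M : PreaddModule B} {Z : B} {z : M.val Z}
    (h : M.IsGenerator z) : M.IsFinitelyGenerated :=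
  ⟨1, fun _ => Z, fun _ => z, fun X m => by
    obtain ⟨φ, rfl⟩ := h X m
    exact ⟨fun _ => φ, by simp [comb, res]⟩⟩

theorem PreaddModule.exists_common_multiple [Nonempty B] [Limits.HasBinaryBiproducts B]
    (M : PreaddModule B) (n : ℕ) (Z : Fin n → B) (x : ∀ j, M.val (Z j)) :
    ∃ (Y : B) (y : M.val Y), ∀ j, ∃ i : Z j ⟶ Y, M.res i y = x j := by
  induction n with
  | zero =>
    -- No zero object is assumed; any object with the element `0` serves the empty family.
    obtain ⟨Y⟩ := ‹Nonempty B›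
    exact ⟨Y, 0, fun j => j.elim0⟩
  | succ n ih =>
    obtain ⟨Y, y, hy⟩ := ih (fun j => Z j.succ) fun j => x j.succ
    refine ⟨Z 0 ⊞ Y, M.res Limits.biprod.fst (x 0) + M.res Limits.biprod.snd y, fun j => ?_⟩
    refine Fin.cases ⟨Limits.biprod.inl, ?_⟩ (fun j => ?_) j
    · rw [map_add, ← res_comp, ← res_comp, Limits.biprod.inl_fst, Limits.biprod.inl_snd, res_id,
        res_zero, add_zero]
    · obtain ⟨i, hi⟩ := hy j
      refine ⟨i ≫ Limits.biprod.inr, ?_⟩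
      rw [map_add, ← res_comp, ← res_comp, Category.assoc, Category.assoc, Limits.biprod.inr_fst,
        Limits.biprod.inr_snd, Limits.comp_zero, res_zero, zero_add, Category.comp_id, hi]

theorem PreaddModule.IsFinitelyGenerated.exists_isGenerator [Nonempty B]
    [Limits.HasBinaryBiproducts B] {M : PreaddModule B} (h : M.IsFinitelyGenerated) :
    ∃ (Z : B) (z : M.val Z), M.IsGenerator z := by
  obtain ⟨n, Z, x, hx⟩ := h
  obtain ⟨Y, y, hy⟩ := M.exists_common_multiple n Z x
  choose i hi using hy
  refine ⟨Y, y, fun X m => ?_⟩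
  obtain ⟨φ, rfl⟩ := hx X m
  refine ⟨∑ j, φ j ≫ i j, ?_⟩
  have hsum : M.res (∑ j, φ j ≫ i j) y = ∑ j, M.res (φ j ≫ i j) y :=
    map_sum (AddMonoidHom.mk' (fun f : X ⟶ Y => M.res f y) fun _ _ => M.res_add _ _ _) _ _
  rw [hsum, comb]
  refine Finset.sum_congr rfl fun j _ => ?_
  rw [res_comp, hi]
  rfl

/-- A submodule of a module with generator `z ∈ M(Z)` pulls back to an ideal of `mor(?, Z)`, and a
generator of that ideal maps to a generator of the submodule. -/
theorem isNoetherianCat_iff [Nonempty B] [Limits.HasBinaryBiproducts B] :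
    IsNoetherianCat B ↔ HasPrincipalIdeals B := by
  constructor
  · intro h Z S hS
    let S' : Sub (free Z) :=
      { carrier := fun X => (S X).map toFree
        res_mem := by
          rintro X Y f _ ⟨g, hg, rfl⟩
          exact ⟨f ≫ g, hS _ _ f g hg, rfl⟩ }
    obtain ⟨Y, y, hy⟩ := (h _ _ S'.incl S'.incl_injective
      (free_isGenerator Z).isFinitelyGenerated).exists_isGenerator
    obtain ⟨a, ha, ha'⟩ := (S'.exists_incl_eq_iff _).1 ⟨y, rfl⟩
    refine ⟨Y, a, fun X φ => ⟨fun hφ => ?_, ?_⟩⟩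
    · obtain ⟨s, hs⟩ := (S'.exists_incl_eq_iff (toFree φ)).2 ⟨φ, hφ, rfl⟩
      obtain ⟨χ, rfl⟩ := hy X s
      rw [app_res, ← ha', res_toFree] at hs
      exact ⟨χ, toFree_injective hs⟩
    · rintro ⟨χ, rfl⟩
      exact hS _ _ χ a ha
  · intro h M N f hf hM
    obtain ⟨Z, z, hz⟩ := hM.exists_isGenerator
    obtain ⟨Y, a, ha⟩ := h Z (fun X =>
      { carrier := {φ | ∃ n, app f X n = M.res φ z}
        zero_mem' := ⟨0, by rw [map_zero, res_zero]⟩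
        add_mem' := by
          rintro φ ψ ⟨n, hn⟩ ⟨m, hm⟩
          exact ⟨n + m, by rw [map_add, hn, hm, res_add]⟩
        neg_mem' := by
          rintro φ ⟨n, hn⟩
          exact ⟨-n, by rw [map_neg, hn, res_neg]⟩ }) (by
      rintro X Y φ ψ ⟨n, hn⟩
      exact ⟨N.res φ n, by rw [app_res, hn, res_comp]⟩)
    obtain ⟨y, hy⟩ := (ha Y a).2 ⟨𝟙 Y, Category.id_comp a⟩
    refine IsGenerator.isFinitelyGenerated (z := y) fun X n => ?_
    obtain ⟨φ, hφ⟩ := hz X (app f X n)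
    obtain ⟨χ, rfl⟩ := (ha X φ).1 ⟨n, hφ.symm⟩
    exact ⟨χ, hf X (by rw [app_res, hy, ← res_comp, hφ])⟩

/-- A weak kernel is a generator of the ideal of morphisms that `a` annihilates. -/
theorem HasPrincipalIdeals.exists_isWeakKernel (h : HasPrincipalIdeals B) {Y Z : B} (a : Y ⟶ Z) :
    ∃ (W : B) (k : W ⟶ Y), IsWeakKernel k a := by
  obtain ⟨W, k, hk⟩ := h Y (fun X => (AddMonoidHom.mk' (fun f : X ⟶ Y => f ≫ a)
    fun _ _ => Preadditive.add_comp _ _ _ _ _ _).ker) (by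
      intro X W f g hg
      rw [AddMonoidHom.mem_ker] at hg ⊢
      rw [AddMonoidHom.mk'_apply] at hg ⊢
      rw [Category.assoc, hg, Limits.comp_zero])
  exact ⟨W, k, hk⟩

theorem HasPrincipalIdeals.exists_isPresentation (h : HasPrincipalIdeals B) {M : PreaddModule B}
    {Z : B} {z : M.val Z} (hz : M.IsGenerator z) :
    ∃ (Y : B) (a : Y ⟶ Z), M.IsPresentation z a := by
  obtain ⟨Y, a, ha⟩ := h Z (fun X => (AddMonoidHom.mk' (fun f : X ⟶ Z => M.res f z)
    fun _ _ => M.res_add _ _ _).ker) (by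
      intro X W f g hg
      rw [AddMonoidHom.mem_ker] at hg ⊢
      rw [AddMonoidHom.mk'_apply] at hg ⊢
      rw [res_comp, hg, map_zero])
  exact ⟨Y, a, hz, fun {X} φ => ha X φ⟩

end Noetherian

/-! ### Finite resolutions versus projective dimension. -/

section Resolutions

variable {B : Type u} [Category.{v} B] [Preadditive B]

theorem PreaddModule.shortExact_ker {M N : PreaddModule B} (p : M ⟶ N)
    (hp : ∀ X, Function.Surjective (app p X)) :
    ∃ w : (Sub.ker p).incl ≫ p = 0, (ShortComplex.mk (Sub.ker p).incl p w).ShortExact :=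
  shortExact _ _ (Sub.incl_injective _) hp fun _ m => ((Sub.ker p).exists_incl_eq_iff m).symm

theorem PreaddModule.isZero_of_subsingleton (M : PreaddModule B)
    (h : ∀ X, Subsingleton (M.val X)) : Limits.IsZero M := by
  rw [Limits.IsZero.iff_id_eq_zero]
  exact hom_ext fun X m => (h X).elim _ _

theorem PreaddModule.HasFiniteProjectiveResolution.hasProjectiveDimensionLE {M : PreaddModule B}
    {l : ℕ} (h : M.HasFiniteProjectiveResolution l) : HasProjectiveDimensionLE M l := by
  induction l generalizing M with
  | zero =>
    obtain ⟨P, d, p, hP, h0, -, hd0, hp⟩ := h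
    obtain ⟨w, S⟩ := shortExact_ker p hp
    have := (hP 0).2
    refine S.hasProjectiveDimensionLT_X₃ 0 (Limits.IsZero.hasProjectiveDimensionLT_zero ?_)
      (inferInstanceAs (HasProjectiveDimensionLT (P 0) 1))
    refine isZero_of_subsingleton _ fun X => ⟨fun m n => Sub.incl_injective _ X ?_⟩
    have key : ∀ m : (Sub.ker p).toModule.val X, app (Sub.ker p).incl X m = 0 := fun m => by
      obtain ⟨y, hy⟩ := (hd0 X _).1 (((Sub.ker p).exists_incl_eq_iff _).1 ⟨m, rfl⟩)
      rw [← hy, (h0 1 one_pos X).elim y 0, map_zero]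
    rw [key, key]
  | succ l ih =>
    obtain ⟨P, d, p, hP, h0, hd, hd0, hp⟩ := h
    obtain ⟨w, S⟩ := shortExact_ker p hp
    -- Cutting the resolution at `P 0`: the corestriction of `d 0` to the kernel of `p` is the
    -- augmentation of the shifted resolution.
    obtain ⟨q, hq⟩ := exists_lift (Sub.ker p).incl (Sub.incl_injective _) (d 0) fun X x =>
      ((Sub.ker p).exists_incl_eq_iff _).2 ((hd0 X _).2 ⟨x, rfl⟩)
    have hq' : ∀ X x, app (Sub.ker p).incl X (app q X x) = app (d 0) X x := fun X x => by
      rw [← app_comp, hq]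
    have := (hP 0).2
    refine S.hasProjectiveDimensionLT_X₃ (l + 1) (ih ?_)
      (inferInstanceAs (HasProjectiveDimensionLT (P 0) (l + 2)))
    refine ⟨fun i => P (i + 1), fun i => d (i + 1), q, fun i => hP (i + 1),
      fun i hi => h0 (i + 1) (by omega), fun i => hd (i + 1), fun X x => ?_, fun X m => ?_⟩
    · rw [← hd 0 X x, ← hq', ← map_zero (app (Sub.ker p).incl X)]
      exact (Sub.incl_injective _ X).eq_iff.symm
    · obtain ⟨x, hx⟩ := (hd0 X _).1 (((Sub.ker p).exists_incl_eq_iff _).1 ⟨m, rfl⟩)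
      exact ⟨x, Sub.incl_injective _ X (by rw [hq', hx])⟩

theorem PreaddModule.HasFiniteProjectiveResolution.splice {M P : PreaddModule B} {l : ℕ} (p : P ⟶ M)
    (hp : ∀ X, Function.Surjective (app p X)) (hP : P.IsFinitelyGenerated) [Projective P]
    (h : (Sub.ker p).toModule.HasFiniteProjectiveResolution l) :
    M.HasFiniteProjectiveResolution (l + 1) := by
  obtain ⟨Q, d, q, hQ, h0, hd, hd0, hq⟩ := h
  let R : ℕ → PreaddModule B := fun i => Nat.casesOn i P Q
  let e : ∀ i, R (i + 1) ⟶ R i := fun i => Nat.casesOn i (q ≫ (Sub.ker p).incl) d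
  refine ⟨R, e, p, fun i => ?_, fun i hi => ?_, fun i => ?_, fun X x => ?_, hp⟩
  · cases i with
    | zero => exact ⟨hP, ‹_›⟩
    | succ i => exact hQ i
  · cases i with
    | zero => omega
    | succ i => exact h0 i (by omega)
  · cases i with
    | zero =>
      intro X x
      refine Iff.trans ?_ (hd0 X x)
      change app (Sub.ker p).incl X (app q X x) = 0 ↔ _
      rw [← map_zero (app (Sub.ker p).incl X)]
      exact (Sub.incl_injective _ X).eq_iff
    | succ i => exact hd i
  · refine ((Sub.ker p).exists_incl_eq_iff x).symm.trans ?_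
    constructor
    · rintro ⟨k, hk⟩
      obtain ⟨y, rfl⟩ := hq X k
      exact ⟨y, hk⟩
    · rintro ⟨y, hy⟩
      exact ⟨app q X y, hy⟩

/-- The zero module. -/
def PreaddModule.zeroModule (B : Type u) [Category.{v} B] [Preadditive B] : PreaddModule B :=
  ofRes (fun _ => PUnit) (fun _ => 0) (fun _ _ => rfl) (fun _ _ _ => rfl) (fun _ _ _ => rfl)

instance (X : B) : Subsingleton ((zeroModule B).val X) := inferInstanceAs (Subsingleton PUnit)

instance : Projective (zeroModule B) := (isZero_of_subsingleton _ inferInstance).projective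

theorem PreaddModule.zeroModule_isFinitelyGenerated : (zeroModule B).IsFinitelyGenerated :=
  ⟨0, fun j => j.elim0, fun j => j.elim0, fun _ _ => ⟨fun j => j.elim0, Subsingleton.elim _ _⟩⟩

theorem PreaddModule.HasFiniteProjectiveResolution.of_projective {M : PreaddModule B}
    (hM : M.IsFinitelyGenerated) [Projective M] : M.HasFiniteProjectiveResolution 0 := by
  let R : ℕ → PreaddModule B := fun i => Nat.casesOn i M fun _ => zeroModule B
  let d : ∀ i : ℕ, R (i + 1) ⟶ R i := fun i =>
    Nat.casesOn i (0 : zeroModule B ⟶ M) fun _ => (0 : zeroModule B ⟶ zeroModule B)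
  refine ⟨R, d, 𝟙 M, fun i => ?_, fun i hi => ?_, fun i X x => ?_, fun X x => ?_,
    fun X => Function.surjective_id⟩
  · cases i with
    | zero => exact ⟨hM, ‹_›⟩
    | succ i => exact ⟨zeroModule_isFinitelyGenerated, inferInstanceAs (Projective (zeroModule B))⟩
  · cases i with
    | zero => omega
    | succ i => exact fun X => inferInstanceAs (Subsingleton ((zeroModule B).val X))
  · have : Subsingleton ((R (i + 1)).val X) := inferInstanceAs (Subsingleton ((zeroModule B).val X))
    exact ⟨fun _ => ⟨0, Subsingleton.elim _ _⟩, fun _ => by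
      rw [Subsingleton.elim x 0, map_zero]⟩
  · exact ⟨fun h => ⟨0, h.symm⟩, fun ⟨_, h⟩ => h.symm⟩

/-- The kernel of a free cover is again finitely generated by the Noetherian hypothesis, and its
projective dimension has dropped by one; resolve it and splice. -/
theorem PreaddModule.hasFiniteProjectiveResolution_of_hasProjectiveDimensionLE [Nonempty B]
    [Limits.HasBinaryBiproducts B] (hB : IsNoetherianCat B) {M : PreaddModule B}
    (hM : M.IsFinitelyGenerated) {l : ℕ} (h : HasProjectiveDimensionLE M l) :
    M.HasFiniteProjectiveResolution l := by
  induction l generalizing M with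
  | zero =>
    have := (projective_iff_hasProjectiveDimensionLE_zero M).2 h
    exact .of_projective hM
  | succ l ih =>
    obtain ⟨Z, z, hz⟩ := hM.exists_isGenerator
    have hF := (free_isGenerator Z).isFinitelyGenerated
    refine .splice (freeLift z) hz.freeLift_surjective hF
      (ih (hB _ _ _ (Sub.incl_injective _) hF) ?_)
    obtain ⟨w, S⟩ := shortExact_ker (freeLift z) hz.freeLift_surjective
    exact (S.hasProjectiveDimensionLT_X₃_iff l (inferInstanceAs (Projective (free Z)))).1 h

theorem PreaddModule.free_isFinitelyGeneratedFree (Z : B) : (free Z).IsFinitelyGeneratedFree :=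
  ⟨1, fun _ => Z, fun _ => toFree (𝟙 Z), fun X => by
    have h : ∀ φ : Fin 1 → (X ⟶ Z), (free Z).comb (fun _ => toFree (𝟙 Z)) X φ = toFree (φ 0) := by
      intro φ
      refine (Fin.sum_univ_one _).trans ?_
      exact (res_toFree (φ 0) (𝟙 Z)).trans (by rw [Category.comp_id])
    constructor
    · intro φ ψ e
      rw [h, h] at e
      funext j
      rw [Subsingleton.elim j 0]
      exact toFree_injective e
    · intro m
      obtain ⟨φ, rfl⟩ := toFree_surjective m
      exact ⟨fun _ => φ, h _⟩⟩

theorem PreaddModule.IsPresentation.isFinitelyPresented {M : PreaddModule B} {Y Z : B}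
    {z : M.val Z} {a : Y ⟶ Z} (h : M.IsPresentation z a) : M.IsFinitelyPresented := by
  refine ⟨free Y, free Z, freeLift (toFree a), freeLift z, free_isFinitelyGeneratedFree Y,
    free_isFinitelyGeneratedFree Z, fun X m => ?_, h.gen.freeLift_surjective⟩
  obtain ⟨φ, rfl⟩ := toFree_surjective m
  rw [freeLift_toFree, h.rel]
  constructor
  · rintro ⟨χ, rfl⟩
    exact ⟨toFree χ, rfl⟩
  · rintro ⟨x, hx⟩
    obtain ⟨χ, rfl⟩ := toFree_surjective x
    exact ⟨χ, toFree_injective hx⟩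

theorem PreaddModule.IsFinitelyPresented.isFinitelyGenerated {M : PreaddModule B}
    (h : M.IsFinitelyPresented) : M.IsFinitelyGenerated := by
  obtain ⟨-, F, -, p, -, ⟨n, Z, x, hx⟩, -, hp⟩ := h
  refine ⟨n, Z, fun j => app p _ (x j), fun X m => ?_⟩
  obtain ⟨y, rfl⟩ := hp X m
  obtain ⟨φ, rfl⟩ := (hx X).2 y
  refine ⟨φ, ?_⟩
  simp only [comb, map_sum]
  exact Finset.sum_congr rfl fun j _ => (app_res p (φ j) (x j)).symm

end Resolutions

/-! ### Regularity in terms of single morphisms. -/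

section Regularity

variable {B : Type u} [Category.{v} B] [Preadditive B]

theorem isUniformlyRegularCat_iff [Nonempty B] [Limits.HasBinaryBiproducts B] (l : ℕ) :
    IsUniformlyRegularCat B l ↔
      HasPrincipalIdeals B ∧ ∀ {Y Z : B} (a : Y ⟶ Z), CokerPdLE l a := by
  rw [IsUniformlyRegularCat, isNoetherianCat_iff]
  refine and_congr_right fun hB => ⟨fun h Y Z a M z hM => ?_, fun h M hM => ?_⟩
  · exact (h M hM.isFinitelyPresented).hasProjectiveDimensionLE
  · obtain ⟨Z, z, hz⟩ := hM.isFinitelyGenerated.exists_isGenerator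
    obtain ⟨Y, a, ha⟩ := hB.exists_isPresentation hz
    exact hasFiniteProjectiveResolution_of_hasProjectiveDimensionLE (isNoetherianCat_iff.2 hB)
      hM.isFinitelyGenerated (h a M z ha)

theorem isRegularCat_iff [Nonempty B] [Limits.HasBinaryBiproducts B] :
    IsRegularCat B ↔
      HasPrincipalIdeals B ∧ ∀ {Y Z : B} (a : Y ⟶ Z), ∃ n, CokerPdLE n a := by
  rw [IsRegularCat, isNoetherianCat_iff]
  refine and_congr_right fun hB => ⟨fun h Y Z a => ?_, fun h M hM => ?_⟩
  · obtain ⟨M, z, hM⟩ := exists_isPresentation a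
    obtain ⟨n, hn⟩ := h M hM.isFinitelyPresented
    exact ⟨n, hM.cokerPdLE_iff.2 hn.hasProjectiveDimensionLE⟩
  · obtain ⟨Z, z, hz⟩ := hM.isFinitelyGenerated.exists_isGenerator
    obtain ⟨Y, a, ha⟩ := hB.exists_isPresentation hz
    obtain ⟨n, hn⟩ := h a
    exact ⟨n, hasFiniteProjectiveResolution_of_hasProjectiveDimensionLE (isNoetherianCat_iff.2 hB)
      hM.isFinitelyGenerated (hn M z ha)⟩

theorem isUniformlyRegularCat_of_isEmpty [IsEmpty B] (l : ℕ) : IsUniformlyRegularCat B l := by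
  have hfg : ∀ M : PreaddModule B, M.IsFinitelyGenerated := fun M =>
    ⟨0, fun j => j.elim0, fun j => j.elim0, fun X => isEmptyElim X⟩
  have hproj : ∀ M : PreaddModule B, Projective M := fun M =>
    (isZero_of_subsingleton M fun X => isEmptyElim X).projective
  exact ⟨fun _ N _ _ _ => hfg N, fun M _ => ⟨fun _ => M, fun _ => 0, 0, fun _ => ⟨hfg M, hproj M⟩,
    fun _ _ X => isEmptyElim X, fun _ X => isEmptyElim X, fun X => isEmptyElim X,
    fun X => isEmptyElim X⟩⟩

theorem IsUniformlyRegularCat.isRegularCat {l : ℕ} (h : IsUniformlyRegularCat B l) :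
    IsRegularCat B :=
  ⟨h.1, fun M hM => ⟨l, h.2 M hM⟩⟩

end Regularity

/-! ### Monomials, powers of `t` and clearing denominators. -/

namespace TwistedLaurent

variable {A : Type u} [Category.{v} A] [Preadditive A] {Φ : AdditiveAutomorphism A}

/-- The monomial `f • t ^ i` as a morphism of the twisted Laurent category. -/
def monHom {X Y : TwistedLaurent Φ} (i : ℤ) (f : (Φ ^ i).hom.obj X.obj ⟶ Y.obj) : X ⟶ Y :=
  monomial i f

theorem monHom_comp {X Y Z : TwistedLaurent Φ} {i j : ℤ} (f : (Φ ^ i).hom.obj X.obj ⟶ Y.obj)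
    (g : (Φ ^ j).hom.obj Y.obj ⟶ Z.obj) : monHom i f ≫ monHom j g = monHom (i + j) (coeffComp f g) :=
  compHom_monomial f g

theorem monHom_congr {X Y : TwistedLaurent Φ} {i j : ℤ} (h : i = j)
    (f : (Φ ^ i).hom.obj X.obj ⟶ Y.obj) (g : (Φ ^ j).hom.obj X.obj ⟶ Y.obj)
    (hfg : f = eqToHom (by rw [h]) ≫ g) : monHom i f = monHom j g :=
  monomial_congr h f g hfg

theorem id_eq_monHom (X : TwistedLaurent Φ) : 𝟙 X = monHom 0 (eqToHom (Φ.zpow_zero_obj X.obj)) := rfl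

theorem monHom_mem_nonneg {X Y : TwistedLaurent Φ} {i : ℤ} (hi : 0 ≤ i)
    (f : (Φ ^ i).hom.obj X.obj ⟶ Y.obj) : monHom i f ∈ nonneg X Y :=
  monomial_mem_nonneg hi f

theorem coeff_monHom_of_ne {X Y : TwistedLaurent Φ} {i j : ℤ} (h : i ≠ j)
    (f : (Φ ^ i).hom.obj X.obj ⟶ Y.obj) : coeff j (monHom i f) = 0 :=
  DirectSum.of_eq_of_ne (β := fun i : ℤ => ((Φ ^ i).hom.obj X.obj ⟶ Y.obj)) i j f h.symm

theorem coeff_monHom {X Y : TwistedLaurent Φ} (i : ℤ) (f : (Φ ^ i).hom.obj X.obj ⟶ Y.obj) :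
    coeff i (monHom i f) = f :=
  DirectSum.of_eq_same (β := fun i : ℤ => ((Φ ^ i).hom.obj X.obj ⟶ Y.obj)) i f

theorem exists_eq_sum_monHom {X Y : TwistedLaurent Φ} (f : X ⟶ Y) :
    ∃ s : Finset ℤ, (∀ i ∈ s, coeff i f ≠ 0) ∧ f = ∑ i ∈ s, monHom i (coeff i f) := by
  classical
  exact ⟨DFinsupp.support (β := fun i : ℤ => ((Φ ^ i).hom.obj X.obj ⟶ Y.obj)) f,
    fun i hi => DFinsupp.mem_support_iff.1 hi,
    (DirectSum.sum_support_of (β := fun i : ℤ => ((Φ ^ i).hom.obj X.obj ⟶ Y.obj)) f).symm⟩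

/-- The isomorphism `t ^ i : X ≅ Φ ^ i X`. -/
def shift (i : ℤ) (X : A) : (⟨X⟩ : TwistedLaurent Φ) ≅ ⟨(Φ ^ i).hom.obj X⟩ where
  hom := monHom i (𝟙 _)
  inv := monHom (-i) (eqToHom (by
    rw [← AdditiveAutomorphism.zpow_add_obj, add_neg_cancel, AdditiveAutomorphism.zpow_zero_obj]))
  hom_inv_id := by
    rw [monHom_comp, id_eq_monHom]
    exact monHom_congr (add_neg_cancel i) _ _ (by simp [coeffComp])
  inv_hom_id := by
    rw [monHom_comp, id_eq_monHom]
    exact monHom_congr (neg_add_cancel i) _ _ (by simp [coeffComp, eqToHom_map])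

theorem exists_fraction {X Y : TwistedLaurent Φ} (f : X ⟶ Y) :
    ∃ (W : A) (e : (⟨W⟩ : TwistedLaurent Φ) ≅ X), e.hom ≫ f ∈ nonneg _ Y := by
  obtain ⟨s, -, hs⟩ := exists_eq_sum_monHom f
  -- Precomposing with the degree `-N` isomorphism moves every exponent `i ≥ N` to `i - N ≥ 0`.
  obtain ⟨N, hN⟩ := s.bddBelow
  refine ⟨(Φ ^ N).hom.obj X.obj, (shift N X.obj).symm, ?_⟩
  rw [hs, Preadditive.comp_sum]
  refine AddSubgroup.sum_mem _ fun i hi => ?_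
  have h : (shift N X.obj).symm.hom ≫ monHom i (coeff i f) = _ := monHom_comp _ _
  rw [h]
  have := hN hi
  exact monHom_mem_nonneg (by omega) _

theorem monHom_zero_comp_shift {X Y : A} (f : X ⟶ Y) :
    (monHom 0 (eqToHom (Φ.zpow_zero_obj X) ≫ f) : (⟨X⟩ : TwistedLaurent Φ) ⟶ ⟨Y⟩) ≫
        (shift 1 Y).hom =
      (shift 1 X).hom ≫ monHom 0 (eqToHom (Φ.zpow_zero_obj _) ≫ (Φ ^ (1 : ℤ)).hom.map f) := by
  refine (monHom_comp _ _).trans (Eq.trans ?_ (monHom_comp _ _).symm)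
  exact monHom_congr (by omega) _ _ (by simp [coeffComp, eqToHom_map])

theorem monHom_one_add {X Y : A} {i j : ℤ} (h : j = 1 + i) (f : (Φ ^ j).hom.obj X ⟶ Y) :
    (monHom j f : (⟨X⟩ : TwistedLaurent Φ) ⟶ ⟨Y⟩) = (shift 1 X).hom ≫
      monHom i (eqToHom (by rw [h, AdditiveAutomorphism.zpow_add_obj]) ≫ f) := by
  subst h
  refine Eq.trans ?_ (monHom_comp _ _).symm
  exact monHom_congr rfl _ _ (by simp [coeffComp])

theorem coeff_zero_shift_comp {X Y : A}
    (f : (⟨(Φ ^ (1 : ℤ)).hom.obj X⟩ : TwistedLaurent Φ) ⟶ ⟨Y⟩) (hf : f ∈ nonneg _ _) :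
    coeff 0 ((shift 1 X).hom ≫ f) = 0 := by
  obtain ⟨s, hs, e⟩ := exists_eq_sum_monHom f
  rw [e, Preadditive.comp_sum, map_sum]
  refine Finset.sum_eq_zero fun i hi => ?_
  have h : (shift 1 X).hom ≫ monHom i (coeff i f) = _ := monHom_comp _ _
  rw [h]
  exact coeff_monHom_of_ne (fun h0 => hs i hi (hf i (by omega))) _

end TwistedLaurent

/-! ### The inclusions of `A_Φ[t]` into the Laurent category and of `A` into `A_Φ[t]`. -/

namespace TwistedPolynomial

variable {A : Type u} [Category.{v} A] [Preadditive A] {Φ : AdditiveAutomorphism A}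

theorem toLaurent_map_injective {X Y : TwistedPolynomial Φ} {f g : X ⟶ Y}
    (h : (toLaurent Φ).map f = (toLaurent Φ).map g) : f = g :=
  Subtype.ext h

theorem toLaurent_exists_fraction {X : TwistedLaurent Φ} {Y : TwistedPolynomial Φ}
    (f : X ⟶ (toLaurent Φ).obj Y) : ∃ (W : TwistedPolynomial Φ) (e : (toLaurent Φ).obj W ≅ X)
      (g : W ⟶ Y), e.hom ≫ f = (toLaurent Φ).map g := by
  obtain ⟨W, e, he⟩ := TwistedLaurent.exists_fraction f
  exact ⟨⟨W⟩, e, ⟨_, he⟩, rfl⟩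

/-- Flatness of the localization: an isomorphism in front makes the annihilated morphism polynomial,
and the factorization found there is carried back. -/
theorem toLaurent_isWeakKernel {W Y Z : TwistedPolynomial Φ} (k : W ⟶ Y) (a : Y ⟶ Z)
    (h : IsWeakKernel k a) : IsWeakKernel ((toLaurent Φ).map k) ((toLaurent Φ).map a) := by
  intro X ψ
  constructor
  · intro hψ
    obtain ⟨V, e, g, hg⟩ := toLaurent_exists_fraction ψ
    obtain ⟨χ, rfl⟩ := (h _ g).1 (toLaurent_map_injective (by
      rw [Functor.map_comp, ← hg, Category.assoc, hψ, Limits.comp_zero, Functor.map_zero]))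
    refine ⟨e.inv ≫ (toLaurent Φ).map χ, ?_⟩
    rw [Category.assoc, ← Functor.map_comp, ← hg, Iso.inv_hom_id_assoc]
  · rintro ⟨χ, rfl⟩
    rw [Category.assoc, ← Functor.map_comp, h.comp_eq_zero, Functor.map_zero, Limits.comp_zero]

/-- A Laurent ideal is generated by its polynomial elements, since every element is one of these up
to an isomorphism of the source. -/
theorem hasPrincipalIdeals_laurent (h : HasPrincipalIdeals (TwistedPolynomial Φ)) :
    HasPrincipalIdeals (TwistedLaurent Φ) := by
  intro Z S hS
  obtain ⟨Z, rfl⟩ : ∃ Z', (toLaurent Φ).obj Z' = Z := ⟨⟨Z.obj⟩, rfl⟩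
  obtain ⟨Y, a, ha⟩ := h Z (fun X => (S ((toLaurent Φ).obj X)).comap (toLaurent Φ).mapAddHom)
    fun X Y f g hg => by
      rw [AddSubgroup.mem_comap, Functor.coe_mapAddHom] at hg ⊢
      rw [Functor.map_comp]
      exact hS _ _ _ _ hg
  refine ⟨(toLaurent Φ).obj Y, (toLaurent Φ).map a, fun X φ => ⟨fun hφ => ?_, ?_⟩⟩
  · obtain ⟨V, e, g, hg⟩ := toLaurent_exists_fraction φ
    obtain ⟨χ, rfl⟩ := (ha _ g).1 (by
      rw [AddSubgroup.mem_comap, Functor.coe_mapAddHom, ← hg]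
      exact hS _ _ _ _ hφ)
    refine ⟨e.inv ≫ (toLaurent Φ).map χ, ?_⟩
    rw [Category.assoc, ← Functor.map_comp, ← hg, e.inv_hom_id_assoc]
  · rintro ⟨χ, rfl⟩
    exact hS _ _ _ _ ((ha _ a).2 ⟨𝟙 _, Category.id_comp a⟩)

theorem cokerPdLE_laurent (h : HasPrincipalIdeals (TwistedPolynomial Φ)) {Y Z : TwistedLaurent Φ}
    (a : Y ⟶ Z) : ∃ (W : TwistedPolynomial Φ) (g : W ⟶ ⟨Z.obj⟩),
      ∀ n, CokerPdLE n g → CokerPdLE n a := by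
  obtain ⟨W, e, g, hg⟩ := toLaurent_exists_fraction (Y := ⟨Z.obj⟩) a
  refine ⟨W, g, fun n hn => CokerPdLE.of_factors (a := (toLaurent Φ).map g) (fun {X} φ => ?_)
    (hn.map (toLaurent Φ) h.exists_isWeakKernel toLaurent_isWeakKernel)⟩
  rw [← hg]
  constructor
  · rintro ⟨χ, rfl⟩
    exact ⟨χ ≫ e.hom, Category.assoc _ _ _⟩
  · rintro ⟨χ, rfl⟩
    exact ⟨χ ≫ e.inv, (Category.assoc _ _ _).trans (congrArg (χ ≫ ·) (e.inv_hom_id_assoc a))⟩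

/-- The morphism `t : X ⟶ Φ X` of `A_Φ[t]`. -/
def t (Φ : AdditiveAutomorphism A) (X : A) :
    (incl Φ).obj X ⟶ (incl Φ).obj ((Φ ^ (1 : ℤ)).hom.obj X) :=
  ⟨(TwistedLaurent.shift 1 X).hom, TwistedLaurent.monHom_mem_nonneg zero_le_one _⟩

theorem incl_map_val {X Y : A} (f : X ⟶ Y) : ((incl Φ).map f).1 =
    TwistedLaurent.monHom 0 (eqToHom (Φ.zpow_zero_obj X) ≫ f) := rfl

theorem incl_comp_t {X Y : A} (f : X ⟶ Y) :
    (incl Φ).map f ≫ t Φ Y = t Φ X ≫ (incl Φ).map ((Φ ^ (1 : ℤ)).hom.map f) :=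
  Subtype.ext (TwistedLaurent.monHom_zero_comp_shift f)

theorem t_comp_injective {X Y : A} {f g : (incl Φ).obj ((Φ ^ (1 : ℤ)).hom.obj X) ⟶ (incl Φ).obj Y}
    (h : t Φ X ≫ f = t Φ X ≫ g) : f = g :=
  Subtype.ext ((cancel_epi (TwistedLaurent.shift 1 X).hom).1 (congrArg Subtype.val h))

theorem coeff_zero_incl_map {X Y : A} (f : X ⟶ Y) : TwistedLaurent.coeff 0 ((incl Φ).map f).1 =
    eqToHom (Φ.zpow_zero_obj X) ≫ f :=
  TwistedLaurent.coeff_monHom (X := ⟨X⟩) (Y := ⟨Y⟩) 0 _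

theorem coeff_zero_t_comp {X Y : A} (f : (incl Φ).obj ((Φ ^ (1 : ℤ)).hom.obj X) ⟶ (incl Φ).obj Y) :
    TwistedLaurent.coeff 0 (t Φ X ≫ f).1 = 0 :=
  TwistedLaurent.coeff_zero_shift_comp f.1 f.2

/-- Uniqueness of the Horner form `f₀ + t f'`: the coefficient at `t ^ 0` sees only `f₀`, and `t`
can be cancelled. The later inductions on degree compare coefficients through this statement alone.
-/
theorem eq_zero_of_incl_add_t_comp {X Y : A} {f : X ⟶ Y}
    {g : (incl Φ).obj ((Φ ^ (1 : ℤ)).hom.obj X) ⟶ (incl Φ).obj Y}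
    (h : (incl Φ).map f + t Φ X ≫ g = 0) : f = 0 ∧ g = 0 := by
  have hf : f = 0 := by
    have h0 : TwistedLaurent.coeff 0 ((incl Φ).map f).1 + TwistedLaurent.coeff 0 (t Φ X ≫ g).1 = 0 :=
      (map_add (TwistedLaurent.coeff 0) _ _).symm.trans
        ((congrArg (fun x => TwistedLaurent.coeff 0 x.1) h).trans (map_zero _))
    rw [coeff_zero_t_comp, add_zero, coeff_zero_incl_map] at h0
    exact (cancel_epi _).1 (h0.trans Limits.comp_zero.symm)
  refine ⟨hf, t_comp_injective ?_⟩
  rwa [hf, Functor.map_zero, zero_add, ← Limits.comp_zero] at h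

/-- The morphisms of degree less than `n`. -/
def DegLT (Φ : AdditiveAutomorphism A) (Y : A) : ℕ → ∀ {X : A},
    ((incl Φ).obj X ⟶ (incl Φ).obj Y) → Prop
  | 0, _, f => f = 0
  | n + 1, X, f => ∃ (f₀ : X ⟶ Y) (f' : (incl Φ).obj ((Φ ^ (1 : ℤ)).hom.obj X) ⟶ (incl Φ).obj Y),
      f = (incl Φ).map f₀ + t Φ X ≫ f' ∧ DegLT Φ Y n f'

namespace DegLT

variable {X Y : A} {n : ℕ}

theorem zero : DegLT Φ Y n (0 : (incl Φ).obj X ⟶ (incl Φ).obj Y) := by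
  induction n generalizing X with
  | zero => rfl
  | succ n ih => exact ⟨0, 0, by simp, ih⟩

theorem add {f g : (incl Φ).obj X ⟶ (incl Φ).obj Y} (hf : DegLT Φ Y n f) (hg : DegLT Φ Y n g) :
    DegLT Φ Y n (f + g) := by
  induction n generalizing X with
  | zero =>
    obtain rfl : f = 0 := hf
    obtain rfl : g = 0 := hg
    exact add_zero _
  | succ n ih =>
    obtain ⟨f₀, f', rfl, hf'⟩ := hf
    obtain ⟨g₀, g', rfl, hg'⟩ := hg
    refine ⟨f₀ + g₀, f' + g', ?_, ih hf' hg'⟩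
    rw [Functor.map_add, Preadditive.comp_add]
    abel

theorem neg {f : (incl Φ).obj X ⟶ (incl Φ).obj Y} (hf : DegLT Φ Y n f) : DegLT Φ Y n (-f) := by
  induction n generalizing X with
  | zero => exact neg_eq_zero.2 hf
  | succ n ih =>
    obtain ⟨f₀, f', rfl, hf'⟩ := hf
    refine ⟨-f₀, -f', ?_, ih hf'⟩
    rw [Functor.map_neg, Preadditive.comp_neg]
    abel

theorem sub {f g : (incl Φ).obj X ⟶ (incl Φ).obj Y} (hf : DegLT Φ Y n f) (hg : DegLT Φ Y n g) :
    DegLT Φ Y n (f - g) := by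
  rw [sub_eq_add_neg]
  exact hf.add hg.neg

theorem incl_comp {W : A} (φ : W ⟶ X) {f : (incl Φ).obj X ⟶ (incl Φ).obj Y} (hf : DegLT Φ Y n f) :
    DegLT Φ Y n ((incl Φ).map φ ≫ f) := by
  induction n generalizing X W with
  | zero =>
    obtain rfl : f = 0 := hf
    exact Limits.comp_zero
  | succ n ih =>
    obtain ⟨f₀, f', rfl, hf'⟩ := hf
    refine ⟨φ ≫ f₀, (incl Φ).map ((Φ ^ (1 : ℤ)).hom.map φ) ≫ f', ?_, ih _ hf'⟩
    rw [Functor.map_comp, Preadditive.comp_add, ← Category.assoc, ← Category.assoc, incl_comp_t]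

theorem succ {f : (incl Φ).obj X ⟶ (incl Φ).obj Y} (hf : DegLT Φ Y n f) : DegLT Φ Y (n + 1) f := by
  induction n generalizing X with
  | zero =>
    obtain rfl : f = 0 := hf
    exact zero
  | succ n ih =>
    obtain ⟨f₀, f', rfl, hf'⟩ := hf
    exact ⟨f₀, f', rfl, ih hf'⟩

theorem mono {m : ℕ} (h : n ≤ m) {f : (incl Φ).obj X ⟶ (incl Φ).obj Y} (hf : DegLT Φ Y n f) :
    DegLT Φ Y m f := by
  induction h with
  | refl => exact hf
  | step _ ih => exact ih.succ

theorem t_comp {f : (incl Φ).obj ((Φ ^ (1 : ℤ)).hom.obj X) ⟶ (incl Φ).obj Y} (hf : DegLT Φ Y n f) :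
    DegLT Φ Y (n + 1) (t Φ X ≫ f) :=
  ⟨0, f, by rw [Functor.map_zero, zero_add], hf⟩

theorem of_t_comp {f : (incl Φ).obj ((Φ ^ (1 : ℤ)).hom.obj X) ⟶ (incl Φ).obj Y}
    (hf : DegLT Φ Y (n + 1) (t Φ X ≫ f)) : DegLT Φ Y n f := by
  obtain ⟨f₀, f', h, hf'⟩ := hf
  have := (eq_zero_of_incl_add_t_comp (f := f₀) (g := f' - f) (by
    rw [Preadditive.comp_sub, h]
    abel)).2
  rwa [← sub_eq_zero.1 this]

end DegLT

theorem incl_map_degLT {X Y : A} (f : X ⟶ Y) : DegLT Φ Y 1 ((incl Φ).map f) :=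
  ⟨f, 0, by rw [Limits.comp_zero, add_zero], rfl⟩

theorem exists_degLT_monomial {X Y : A} (i : ℕ) (f : (Φ ^ (i : ℤ)).hom.obj X ⟶ Y) :
    DegLT Φ Y (i + 1) (⟨TwistedLaurent.monHom (i : ℤ) f,
      TwistedLaurent.monHom_mem_nonneg (Int.natCast_nonneg i) f⟩ : (incl Φ).obj X ⟶ (incl Φ).obj Y) := by
  induction i generalizing X with
  | zero =>
    refine ⟨eqToHom (Φ.zpow_zero_obj X).symm ≫ f, 0, ?_, rfl⟩
    rw [Limits.comp_zero, add_zero]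
    refine Subtype.ext ?_
    rw [incl_map_val]
    exact TwistedLaurent.monHom_congr (X := ⟨X⟩) (Y := ⟨Y⟩) rfl _ _ (by simp)
  | succ i ih =>
    have h : (((i + 1 : ℕ) : ℤ)) = 1 + (i : ℤ) := by push_cast; ring
    refine ⟨0, _, ?_, ih (eqToHom (by rw [h, AdditiveAutomorphism.zpow_add_obj]) ≫ f)⟩
    rw [Functor.map_zero, zero_add]
    exact Subtype.ext (TwistedLaurent.monHom_one_add h f)

theorem exists_degLT {X Y : A} (f : (incl Φ).obj X ⟶ (incl Φ).obj Y) : ∃ n, DegLT Φ Y n f := by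
  obtain ⟨s, hs, hf⟩ := TwistedLaurent.exists_eq_sum_monHom f.1
  -- The induction runs over partial sums; staying inside the support of `f` keeps the exponents
  -- nonnegative, so that each partial sum is again polynomial.
  have key : ∀ r : Finset ℤ, r ⊆ s → ∃ g : (incl Φ).obj X ⟶ (incl Φ).obj Y,
      (∃ n, DegLT Φ Y n g) ∧ g.1 = ∑ i ∈ r, TwistedLaurent.monHom i (TwistedLaurent.coeff i f.1) := by
    classical
    intro r
    induction r using Finset.induction_on with
    | empty => exact fun _ => ⟨0, ⟨0, rfl⟩, rfl⟩
    | insert i r hi ih =>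
      intro hr
      obtain ⟨g, ⟨n, hn⟩, hg⟩ := ih ((Finset.subset_insert i r).trans hr)
      have h0 : 0 ≤ i := by
        by_contra h
        exact hs i (hr (Finset.mem_insert_self i r)) (f.2 i (not_le.1 h))
      obtain ⟨j, rfl⟩ := Int.eq_ofNat_of_zero_le h0
      have hj := exists_degLT_monomial (Φ := Φ) j (TwistedLaurent.coeff (j : ℤ) f.1)
      refine ⟨_, ⟨_, (hj.mono (le_max_left _ n)).add (hn.mono (le_max_right (j + 1) n))⟩, ?_⟩
      rw [Finset.sum_insert hi, ← hg]
      rfl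
  obtain ⟨g, hn, hg⟩ := key s subset_rfl
  rwa [show f = g from Subtype.ext (hf.trans hg.symm)]

/-- Composition with a morphism of `A` on the target side acts on each coefficient separately, so
the factorization is found coefficient by coefficient, by induction on the degree. -/
theorem incl_isWeakKernel {W Y Z : A} (k : W ⟶ Y) (a : Y ⟶ Z) (h : IsWeakKernel k a) :
    IsWeakKernel ((incl Φ).map k) ((incl Φ).map a) := by
  intro X ψ
  obtain ⟨X, rfl⟩ : ∃ X', (incl Φ).obj X' = X := ⟨X.obj, rfl⟩
  constructor
  · intro hψ
    obtain ⟨n, hn⟩ := exists_degLT ψ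
    induction n generalizing X with
    | zero => exact ⟨0, Limits.zero_comp.trans hn.symm⟩
    | succ n ih =>
      obtain ⟨f₀, f', rfl, hf'⟩ := hn
      rw [Preadditive.add_comp, Category.assoc] at hψ
      have hψ' := eq_zero_of_incl_add_t_comp (f := f₀ ≫ a) (g := f' ≫ (incl Φ).map a)
        (by rw [Functor.map_comp]; exact hψ)
      obtain ⟨χ₀, rfl⟩ := (h _ _).1 hψ'.1
      obtain ⟨χ', rfl⟩ := ih _ f' hψ'.2 hf'
      refine ⟨(incl Φ).map χ₀ + t Φ X ≫ χ', ?_⟩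
      rw [Functor.map_comp, Preadditive.add_comp, Category.assoc]
  · rintro ⟨χ, rfl⟩
    rw [Category.assoc, ← Functor.map_comp, h.comp_eq_zero, Functor.map_zero, Limits.comp_zero]

end TwistedPolynomial

instance AdditiveAutomorphism.isEquivalence_hom {A : Type u} [Category.{v} A] [Preadditive A]
    (Φ : AdditiveAutomorphism A) : Φ.hom.IsEquivalence :=
  (CategoryTheory.Equivalence.mk Φ.hom Φ.inv (eqToIso Φ.hom_inv_id.symm)
    (eqToIso Φ.inv_hom_id)).isEquivalence_functor

/-! ### Hilbert's basis theorem and syzygy theorem. -/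

namespace TwistedPolynomial

variable {A : Type u} [Category.{v} A] [Preadditive A] {Φ : AdditiveAutomorphism A}

/-- The `n`-fold iterate of `Φ`. -/
def iter (Φ : AdditiveAutomorphism A) : ℕ → A ⥤ A
  | 0 => 𝟭 A
  | n + 1 => (Φ ^ (1 : ℤ)).hom ⋙ iter Φ n

instance (n : ℕ) : (iter Φ n).IsEquivalence := by
  induction n with
  | zero => exact inferInstanceAs (𝟭 A).IsEquivalence
  | succ n ih => exact inferInstanceAs ((Φ ^ (1 : ℤ)).hom ⋙ iter Φ n).IsEquivalence

/-- The morphism `t ^ n : X ⟶ Φ ^ n X`. -/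
noncomputable def tPow (Φ : AdditiveAutomorphism A) : ∀ (n : ℕ) (X : A),
    (incl Φ).obj X ⟶ (incl Φ).obj ((iter Φ n).obj X)
  | 0, X => 𝟙 ((incl Φ).obj X)
  | n + 1, X => t Φ X ≫ tPow Φ n ((Φ ^ (1 : ℤ)).hom.obj X)

theorem tPow_succ_comp (n : ℕ) {X Y : A}
    (c : (iter Φ n).obj ((Φ ^ (1 : ℤ)).hom.obj X) ⟶ Y) :
    tPow Φ (n + 1) X ≫ (incl Φ).map (X := (iter Φ (n + 1)).obj X) c =
      t Φ X ≫ tPow Φ n ((Φ ^ (1 : ℤ)).hom.obj X) ≫ (incl Φ).map c :=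
  Category.assoc _ _ _

theorem incl_comp_tPow (n : ℕ) {X Y : A} (f : X ⟶ Y) :
    (incl Φ).map f ≫ tPow Φ n Y = tPow Φ n X ≫ (incl Φ).map ((iter Φ n).map f) := by
  induction n generalizing X Y with
  | zero => exact (Category.comp_id _).trans (Category.id_comp _).symm
  | succ n ih =>
    have h : ((incl Φ).map f ≫ t Φ Y) ≫ tPow Φ n _ =
        t Φ X ≫ tPow Φ n _ ≫ (incl Φ).map ((iter Φ n).map ((Φ ^ (1 : ℤ)).hom.map f)) := by
      rw [incl_comp_t, Category.assoc, ih]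
    exact (Category.assoc _ _ _).symm.trans (h.trans (tPow_succ_comp n _).symm)

theorem tPow_comp_degLT (n : ℕ) {X Y : A} (c : (iter Φ n).obj X ⟶ Y) :
    DegLT Φ Y (n + 1) (tPow Φ n X ≫ (incl Φ).map c) := by
  induction n generalizing X with
  | zero => exact (congrArg (DegLT Φ Y 1) (Category.id_comp ((incl Φ).map c))).mpr (incl_map_degLT c)
  | succ n ih =>
    rw [tPow_succ_comp n c]
    exact (ih c).t_comp

/-- Unfolding the Horner form `n` times exposes the coefficient of `t ^ n`, whose source is `Φ ^ n
X`. -/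
theorem DegLT.exists_leading {n : ℕ} {X Y : A} {f : (incl Φ).obj X ⟶ (incl Φ).obj Y}
    (hf : DegLT Φ Y (n + 1) f) :
    ∃ c : (iter Φ n).obj X ⟶ Y, DegLT Φ Y n (f - tPow Φ n X ≫ (incl Φ).map c) := by
  induction n generalizing X with
  | zero =>
    obtain ⟨f₀, f', rfl, h⟩ := hf
    obtain rfl : f' = 0 := h
    refine ⟨f₀, ?_⟩
    have h : tPow Φ 0 X ≫ (incl Φ).map f₀ = (incl Φ).map f₀ := Category.id_comp _
    change _ - _ = _
    rw [h, Limits.comp_zero, add_zero, sub_self]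
  | succ n ih =>
    obtain ⟨f₀, f', rfl, hf'⟩ := hf
    obtain ⟨c, hc⟩ := ih hf'
    refine ⟨c, f₀, _, ?_, hc⟩
    rw [tPow_succ_comp n c, Preadditive.comp_sub, add_sub_assoc]

/-- A submodule, over `A_Φ[t]`, of `mor(?, Y)`. -/
structure PolyIdeal (Φ : AdditiveAutomorphism A) (Y : A) where
  carrier : ∀ X : A, AddSubgroup ((incl Φ).obj X ⟶ (incl Φ).obj Y)
  comp_mem : ∀ {W X : A} (g : (incl Φ).obj W ⟶ (incl Φ).obj X) {f}, f ∈ carrier X → g ≫ f ∈ carrier W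

/-- The submodule generated by one morphism. -/
noncomputable def PolyIdeal.span {Y Z : A} (z : (incl Φ).obj Z ⟶ (incl Φ).obj Y) : PolyIdeal Φ Y where
  carrier X := (AddMonoidHom.mk' (fun φ : (incl Φ).obj X ⟶ (incl Φ).obj Z => φ ≫ z)
    fun _ _ => Preadditive.add_comp _ _ _ _ _ _).range
  comp_mem := by
    rintro W X g _ ⟨φ, rfl⟩
    exact ⟨g ≫ φ, Category.assoc g φ z⟩

theorem PolyIdeal.mem_span {X Y Z : A} {z : (incl Φ).obj Z ⟶ (incl Φ).obj Y}
    {f : (incl Φ).obj X ⟶ (incl Φ).obj Y} : f ∈ (span z).carrier X ↔ ∃ φ, φ ≫ z = f :=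
  Iff.rfl

/-- The leading coefficients in degree `n` of the elements of degree at most `n` of `K`. -/
def PolyIdeal.leading {Y : A} (K : PolyIdeal Φ Y) (n : ℕ) (W : A) : AddSubgroup (W ⟶ Y) where
  -- Leading coefficients naturally have source `Φ ^ n X`. Testing against all `e` gives a meaning
  -- for arbitrary `W` and makes stability under precomposition immediate.
  carrier := {c | ∀ (X : A) (e : (iter Φ n).obj X ⟶ W), ∃ f ∈ K.carrier X,
    DegLT Φ Y n (f - tPow Φ n X ≫ (incl Φ).map (e ≫ c))}
  zero_mem' X e := ⟨0, zero_mem _, by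
    rw [Limits.comp_zero, Functor.map_zero, Limits.comp_zero, sub_zero]
    exact DegLT.zero⟩
  add_mem' {c d} hc hd X e := by
    obtain ⟨f, hf, hfc⟩ := hc X e
    obtain ⟨g, hg, hgd⟩ := hd X e
    refine ⟨f + g, add_mem hf hg, ?_⟩
    rw [Preadditive.comp_add, Functor.map_add, Preadditive.comp_add, add_sub_add_comm]
    exact hfc.add hgd
  neg_mem' {c} hc X e := by
    obtain ⟨f, hf, hfc⟩ := hc X e
    refine ⟨-f, neg_mem hf, ?_⟩
    rw [Preadditive.comp_neg, Functor.map_neg, Preadditive.comp_neg, ← neg_sub']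
    exact hfc.neg

namespace PolyIdeal

variable {Y : A} (K : PolyIdeal Φ Y)

theorem comp_mem_leading {n : ℕ} {V W : A} (g : V ⟶ W) {c : W ⟶ Y} (hc : c ∈ K.leading n W) :
    g ≫ c ∈ K.leading n V := fun X e => by
  rw [← Category.assoc]
  exact hc X (e ≫ g)

theorem leading_le_succ (n : ℕ) (W : A) : K.leading n W ≤ K.leading (n + 1) W := by
  intro c hc X e
  obtain ⟨f, hf, hfc⟩ := hc ((Φ ^ (1 : ℤ)).hom.obj X) e
  refine ⟨t Φ X ≫ f, K.comp_mem _ hf, ?_⟩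
  have h := hfc.t_comp
  rw [Preadditive.comp_sub] at h
  exact (congrArg (fun x => DegLT Φ Y (n + 1) (t Φ X ≫ f - x)) (tPow_succ_comp n (e ≫ c))).mpr h

theorem leading_mono {n m : ℕ} (h : n ≤ m) (W : A) : K.leading n W ≤ K.leading m W := by
  induction h with
  | refl => exact le_rfl
  | step _ ih => exact ih.trans (K.leading_le_succ _ W)

theorem mem_leading {n : ℕ} {X : A} {c : (iter Φ n).obj X ⟶ Y}
    {f : (incl Φ).obj X ⟶ (incl Φ).obj Y} (hf : f ∈ K.carrier X)
    (h : DegLT Φ Y n (f - tPow Φ n X ≫ (incl Φ).map c)) : c ∈ K.leading n ((iter Φ n).obj X) := by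
  -- Fullness of `Φ ^ n` writes `e` as `Φ ^ n (ε)`, and precomposing `f` with `ε` multiplies its
  -- leading coefficient by `e`.
  intro W e
  obtain ⟨ε, rfl⟩ := (iter Φ n).map_surjective e
  refine ⟨(incl Φ).map ε ≫ f, K.comp_mem _ hf, ?_⟩
  rw [Functor.map_comp, ← Category.assoc, ← incl_comp_tPow, Category.assoc, ← Preadditive.comp_sub]
  exact h.incl_comp ε

end PolyIdeal

/-- A submodule, over `A`, of the polynomials of degree less than `n` is generated by one element. -/
theorem exists_generator_of_degLT [Limits.HasBinaryBiproducts A] (hA : HasPrincipalIdeals A) {Y : A}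
    (n : ℕ) (L : ∀ X : A, AddSubgroup ((incl Φ).obj X ⟶ (incl Φ).obj Y))
    (hL : ∀ {W X : A} (g : W ⟶ X) {f}, f ∈ L X → (incl Φ).map g ≫ f ∈ L W)
    (hn : ∀ (X : A), ∀ f ∈ L X, DegLT Φ Y n f) :
    ∃ (Z : A), ∃ z ∈ L Z, ∀ (X : A), ∀ f ∈ L X, ∃ φ : X ⟶ Z, (incl Φ).map φ ≫ z = f := by
  induction n generalizing L with
  | zero =>
    refine ⟨Y, 0, zero_mem _, fun X f hf => ⟨0, ?_⟩⟩
    rw [Limits.comp_zero]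
    exact (hn X f hf).symm
  | succ n ih =>
    let F := (Φ ^ (1 : ℤ)).hom
    -- The ideal of constant coefficients of elements of `L`; `hz₁` below lifts its generator to
    -- `L`.
    obtain ⟨Z₁, a, ha⟩ := hA Y (fun X =>
      { carrier := {f₀ | ∃ f', (incl Φ).map f₀ + t Φ X ≫ f' ∈ L X}
        zero_mem' := ⟨0, by
          rw [Functor.map_zero, Limits.comp_zero, add_zero]
          exact zero_mem _⟩
        add_mem' := by
          rintro f₀ g₀ ⟨f', hf⟩ ⟨g', hg⟩
          refine ⟨f' + g', ?_⟩
          rw [Functor.map_add, Preadditive.comp_add, add_add_add_comm]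
          exact add_mem hf hg
        neg_mem' := by
          rintro f₀ ⟨f', hf⟩
          refine ⟨-f', ?_⟩
          rw [Functor.map_neg, Preadditive.comp_neg, ← neg_add]
          exact neg_mem hf }) (by
      rintro W X g f₀ ⟨f', hf⟩
      refine ⟨(incl Φ).map (F.map g) ≫ f', ?_⟩
      rw [← Category.assoc, ← incl_comp_t, Category.assoc, Functor.map_comp, ← Preadditive.comp_add]
      exact hL g hf)
    obtain ⟨a', hz₁⟩ := (ha Z₁ a).2 ⟨𝟙 _, Category.id_comp a⟩
    -- The elements of `L` without constant coefficient, divided by `t`. They have smaller degree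
    -- and live over `Φ X`, hence the test morphisms `e`.
    obtain ⟨Z', z', hz', hgen⟩ := ih (fun W =>
      { carrier := {f | ∀ (X : A) (e : F.obj X ⟶ W), t Φ X ≫ (incl Φ).map e ≫ f ∈ L X}
        zero_mem' := fun X e => by
          rw [Limits.comp_zero, Limits.comp_zero]
          exact zero_mem _
        add_mem' := fun {f g} hf hg X e => by
          rw [Preadditive.comp_add, Preadditive.comp_add]
          exact add_mem (hf X e) (hg X e)
        neg_mem' := fun {f} hf X e => by
          rw [Preadditive.comp_neg, Preadditive.comp_neg]
          exact neg_mem (hf X e) }) (fun {V W} g f hf X e => by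
      rw [← Category.assoc ((incl Φ).map e), ← Functor.map_comp]
      exact hf X (e ≫ g)) (fun W f hf => by
      have h := (hn _ _ (hf _ (F.objObjPreimageIso W).hom)).of_t_comp.incl_comp
        (F.objObjPreimageIso W).inv
      rwa [← Category.assoc, ← Functor.map_comp, Iso.inv_hom_id, CategoryTheory.Functor.map_id,
        Category.id_comp] at h)
    -- Multiplying `z'` by `t` needs a source whose image under `Φ` is isomorphic to `Z'`.
    let V := F.objPreimage Z'
    let e : F.obj V ≅ Z' := F.objObjPreimageIso Z'
    refine ⟨Z₁ ⊞ V, (incl Φ).map Limits.biprod.fst ≫ ((incl Φ).map a + t Φ Z₁ ≫ a') +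
      (incl Φ).map Limits.biprod.snd ≫ t Φ V ≫ (incl Φ).map e.hom ≫ z',
      add_mem (hL _ hz₁) (hL _ (hz' V e.hom)), fun X f hf => ?_⟩
    obtain ⟨f₀, f', rfl, -⟩ := hn X f hf
    obtain ⟨χ, rfl⟩ := (ha X f₀).1 ⟨f', hf⟩
    have hdiff : (incl Φ).map (χ ≫ a) + t Φ X ≫ f' - (incl Φ).map χ ≫ ((incl Φ).map a + t Φ Z₁ ≫ a') =
        t Φ X ≫ (f' - (incl Φ).map (F.map χ) ≫ a') := by
      rw [Functor.map_comp, Preadditive.comp_add, Preadditive.comp_sub, ← Category.assoc _ (t Φ Z₁),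
        incl_comp_t, Category.assoc]
      abel
    have hmem := sub_mem hf (hL χ hz₁)
    rw [hdiff] at hmem
    obtain ⟨φ, hφ⟩ := hgen _ (f' - (incl Φ).map (F.map χ) ≫ a') (fun W ε => by
      obtain ⟨ε, rfl⟩ := F.map_surjective ε
      rw [← Category.assoc, ← incl_comp_t, Category.assoc]
      exact hL ε hmem)
    obtain ⟨ψ, hψ⟩ := F.map_surjective (φ ≫ e.inv)
    refine ⟨Limits.biprod.lift χ ψ, ?_⟩
    rw [Preadditive.comp_add, ← Category.assoc, ← Functor.map_comp, Limits.biprod.lift_fst,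
      ← Category.assoc ((incl Φ).map (Limits.biprod.lift χ ψ)), ← Functor.map_comp,
      Limits.biprod.lift_snd, ← Category.assoc _ (t Φ V), incl_comp_t]
    have hψe : F.map ψ ≫ e.hom = φ := by rw [hψ, Category.assoc, e.inv_hom_id, Category.comp_id]
    rw [Category.assoc, ← Category.assoc ((incl Φ).map _), ← Functor.map_comp]
    change _ + t Φ X ≫ (incl Φ).map (F.map ψ ≫ e.hom) ≫ z' = _
    rw [hψe, hφ, ← hdiff]
    abel

/-- The elements of degree less than `n` of an ideal. -/
def PolyIdeal.bounded {Y : A} (K : PolyIdeal Φ Y) (n : ℕ) (X : A) :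
    AddSubgroup ((incl Φ).obj X ⟶ (incl Φ).obj Y) where
  carrier := {f | f ∈ K.carrier X ∧ DegLT Φ Y n f}
  zero_mem' := ⟨zero_mem _, DegLT.zero⟩
  add_mem' hf hg := ⟨add_mem hf.1 hg.1, hf.2.add hg.2⟩
  neg_mem' hf := ⟨neg_mem hf.1, hf.2.neg⟩

theorem PolyIdeal.exists_generator_bounded [Limits.HasBinaryBiproducts A]
    (hA : HasPrincipalIdeals A) {Y : A} (K : PolyIdeal Φ Y) (n : ℕ) :
    ∃ (Z : A), ∃ z ∈ K.bounded n Z, ∀ (X : A), ∀ f ∈ K.bounded n X,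
      ∃ φ : X ⟶ Z, (incl Φ).map φ ≫ z = f :=
  exists_generator_of_degLT hA n (K.bounded n)
    (fun g _ hf => ⟨K.comp_mem _ hf.1, hf.2.incl_comp g⟩) fun _ _ hf => hf.2

/-- Hilbert's basis theorem: an ideal is generated by its elements of some bounded degree. -/
theorem PolyIdeal.exists_generator [Limits.HasBinaryBiproducts A] (hA : HasPrincipalIdeals A)
    {Y : A} (K : PolyIdeal Φ Y) : ∃ (n : ℕ) (Z : A), ∃ z ∈ K.bounded (n + 1) Z,
      (∀ (X : A), ∀ f ∈ K.bounded (n + 1) X, ∃ φ : X ⟶ Z, (incl Φ).map φ ≫ z = f) ∧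
      ∀ (X : A), ∀ f ∈ K.carrier X, ∃ φ, φ ≫ z = f := by
  -- The union over all degrees of the ideals of leading coefficients. Its single generator `a` lies
  -- in one stage `n`, so the chain is stationary from there on.
  obtain ⟨W, a, ha⟩ := hA Y (fun X =>
    { carrier := {c | ∃ n, c ∈ K.leading n X}
      zero_mem' := ⟨0, zero_mem _⟩
      add_mem' := by
        rintro c d ⟨n, hc⟩ ⟨m, hd⟩
        exact ⟨max n m, add_mem (K.leading_mono (le_max_left n m) X hc)
          (K.leading_mono (le_max_right n m) X hd)⟩
      neg_mem' := by
        rintro c ⟨n, hc⟩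
        exact ⟨n, neg_mem hc⟩ }) (by
    rintro V X g c ⟨n, hc⟩
    exact ⟨n, K.comp_mem_leading g hc⟩)
  obtain ⟨n, hn⟩ := (ha W a).2 ⟨𝟙 _, Category.id_comp a⟩
  obtain ⟨Z, z, hz, hgen⟩ := K.exists_generator_bounded hA (n + 1)
  refine ⟨n, Z, z, hz, hgen, fun X f hf => ?_⟩
  have hsub : ∀ (X : A), ∀ f ∈ (span z).carrier X, f ∈ K.carrier X := by
    rintro X _ ⟨φ, rfl⟩
    exact K.comp_mem φ hz.1
  have hlead : a ∈ (span z).leading n W := fun X e => by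
    obtain ⟨f, hf, hfa⟩ := hn X e
    obtain ⟨φ, hφ⟩ := hgen X f ⟨hf, by
      have := hfa.succ.add (tPow_comp_degLT n (e ≫ a))
      rwa [sub_add_cancel] at this⟩
    exact ⟨f, mem_span.2 ⟨_, hφ⟩, hfa⟩
  -- Division: above degree `n`, the leading coefficient of `f` is a multiple of `a`, so an element
  -- of the span with the same leading term can be subtracted.
  have key : ∀ (m : ℕ) (f : (incl Φ).obj X ⟶ (incl Φ).obj Y), f ∈ K.carrier X → DegLT Φ Y (n + 1 + m) f →
      f ∈ (span z).carrier X := by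
    intro m
    induction m with
    | zero =>
      intro f hf hd
      obtain ⟨φ, hφ⟩ := hgen X f ⟨hf, hd⟩
      exact mem_span.2 ⟨_, hφ⟩
    | succ m ih =>
      intro f hf hd
      obtain ⟨c, hc⟩ := DegLT.exists_leading (n := n + 1 + m) hd
      obtain ⟨χ, rfl⟩ := (ha _ c).1 ⟨_, K.mem_leading hf hc⟩
      obtain ⟨g, hg, hga⟩ := (span z).leading_mono (m := n + 1 + m) (by omega) W hlead X χ
      have h := ih (f - g) (sub_mem hf (hsub X g hg)) (by
        have := hc.sub hga
        rwa [sub_sub_sub_cancel_right] at this)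
      have := add_mem h hg
      rwa [sub_add_cancel] at this
  obtain ⟨m, hm⟩ := exists_degLT f
  exact mem_span.1 (key m f hf (hm.mono (by omega)))

theorem hasPrincipalIdeals [Limits.HasBinaryBiproducts A] (hA : HasPrincipalIdeals A) :
    HasPrincipalIdeals (TwistedPolynomial Φ) := by
  intro Y S hS
  obtain ⟨Y, rfl⟩ : ∃ Y', (incl Φ).obj Y' = Y := ⟨Y.obj, rfl⟩
  obtain ⟨n, Z, z, hz, -, hgen⟩ := PolyIdeal.exists_generator hA (Φ := Φ) (Y := Y)
    ⟨fun X => S ((incl Φ).obj X), fun g f hf => hS _ _ g f hf⟩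
  refine ⟨_, z, fun X φ => ⟨hgen X.obj φ, ?_⟩⟩
  rintro ⟨χ, rfl⟩
  exact hS _ _ _ _ hz.1

/-- Hilbert's syzygy theorem for a single morphism of `A_Φ[t]`. -/
theorem exists_cokerPdLE [Limits.HasBinaryBiproducts A] (hA : HasPrincipalIdeals A)
    {X Y : TwistedPolynomial Φ} (d : X ⟶ Y) :
    ∃ (V₁ V₀ Z₁ Z₀ : A) (b : V₁ ⟶ V₀) (a : Z₁ ⟶ Z₀),
      ∀ n, CokerPdLE n b → CokerPdLE (n + 1) a → CokerPdLE (n + 2) d := by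
  obtain ⟨X₀, rfl⟩ : ∃ X', (incl Φ).obj X' = X := ⟨X.obj, rfl⟩
  obtain ⟨Y, rfl⟩ : ∃ Y', (incl Φ).obj Y' = Y := ⟨Y.obj, rfl⟩
  let F := (Φ ^ (1 : ℤ)).hom
  let K := PolyIdeal.span d
  obtain ⟨n, Z₀, z, hz, hgen, hspan⟩ := K.exists_generator hA
  obtain ⟨W, w', hw', hgen'⟩ := K.exists_generator_bounded hA n
  let V := F.objPreimage W
  let e : F.obj V ≅ W := F.objObjPreimageIso W
  -- The generator of `K_{<n}` is moved to a source of the form `Φ V`, so that `t Φ V ≫ w` makes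
  -- sense and multiples are indexed by morphisms into `V`.
  obtain ⟨w, hw, hwgen⟩ : ∃ w ∈ K.bounded n (F.obj V), ∀ (X : A), ∀ f ∈ K.bounded n (F.obj X),
      ∃ x : X ⟶ V, (incl Φ).map (F.map x) ≫ w = f := by
    refine ⟨(incl Φ).map e.hom ≫ w', ⟨K.comp_mem _ hw'.1, hw'.2.incl_comp _⟩, fun X f hf => ?_⟩
    obtain ⟨φ, rfl⟩ := hgen' _ f hf
    obtain ⟨x, hx⟩ := F.map_surjective (φ ≫ e.inv)
    refine ⟨x, ?_⟩
    rw [← Category.assoc, ← Functor.map_comp, hx, Category.assoc, e.inv_hom_id, Category.comp_id]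
  -- In terms of the generator `z` of `K_{≤n}`, `τ₀` describes multiplication by `t` from `K_{<n}`,
  -- and `ι` the inclusion. Next, `a` and `b` generate the relations over `A` on `z` and on `w`.
  obtain ⟨τ₀, hτ₀⟩ := hgen V (t Φ V ≫ w) ⟨K.comp_mem _ hw.1, hw.2.t_comp⟩
  obtain ⟨ι, hι⟩ := hgen _ w ⟨hw.1, hw.2.succ⟩
  obtain ⟨Z₁, a, ha⟩ : ∃ (Z₁ : A) (a : Z₁ ⟶ Z₀), ∀ (X : A) (φ : X ⟶ Z₀),
      (incl Φ).map φ ≫ z = 0 ↔ ∃ χ, χ ≫ a = φ :=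
    hA Z₀ (fun X => (AddMonoidHom.mk' (fun φ : X ⟶ Z₀ => (incl Φ).map φ ≫ z) fun φ ψ => by
      rw [Functor.map_add, Preadditive.add_comp]).ker) fun X W f g (hg : (incl Φ).map g ≫ z = 0) =>
        show (incl Φ).map (f ≫ g) ≫ z = 0 by
          rw [Functor.map_comp, Category.assoc, hg, Limits.comp_zero]
  obtain ⟨V₁, b, hb⟩ : ∃ (V₁ : A) (b : V₁ ⟶ V), ∀ (X : A) (φ : X ⟶ V),
      (incl Φ).map (F.map φ) ≫ w = 0 ↔ ∃ χ, χ ≫ b = φ :=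
    hA V (fun X => (AddMonoidHom.mk' (fun φ : X ⟶ V => (incl Φ).map (F.map φ) ≫ w) fun φ ψ => by
      rw [Functor.map_add, Functor.map_add, Preadditive.add_comp]).ker)
      fun X W f g (hg : (incl Φ).map (F.map g) ≫ w = 0) =>
        show (incl Φ).map (F.map (f ≫ g)) ≫ w = 0 by
          rw [Functor.map_comp, Functor.map_comp, Category.assoc, hg, Limits.comp_zero]
  refine ⟨V₁, V, Z₁, Z₀, b, a, fun l Hb Ha => ?_⟩
  obtain ⟨C, c, hc⟩ := (hasPrincipalIdeals (Φ := Φ) hA).exists_isWeakKernel z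
  -- Since `d` and `z` have the same image `K`, `d` may be replaced by `z`; its weak kernel `c` then
  -- presents `K`.
  refine CokerPdLE.of_factors (a := z) (fun {X'} φ => ⟨?_, ?_⟩) ((hc.cokerPdLE_succ_iff _).2 ?_)
  · rintro ⟨χ, rfl⟩
    exact K.comp_mem (W := X'.obj) χ hz.1
  · exact hspan X'.obj φ
  have hwk := fun {Y Z : A} (a : Y ⟶ Z) => hA.exists_isWeakKernel a
  have haz : (incl Φ).map a ≫ z = 0 := (ha _ a).2 ⟨𝟙 _, Category.id_comp a⟩
  have hbw : (incl Φ).map (F.map b) ≫ w = 0 := (hb _ b).2 ⟨𝟙 _, Category.id_comp b⟩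
  have ht : ∀ {X : A} (x : X ⟶ V), (incl Φ).map (x ≫ τ₀) ≫ z = t Φ X ≫ (incl Φ).map (F.map x) ≫ w := by
    intro X x
    rw [Functor.map_comp, Category.assoc, hτ₀, ← Category.assoc, incl_comp_t, Category.assoc]
  have hi : ∀ {X : A} (x : X ⟶ V),
      (incl Φ).map (F.map x ≫ ι) ≫ z = (incl Φ).map (F.map x) ≫ w := by
    intro X x
    rw [Functor.map_comp, Category.assoc, hι]
  -- The difference of the two ways to multiply by `t`. It induces the first map of the short exact
  -- sequence and dies in `K`.
  let τ := (incl Φ).map τ₀ - t Φ V ≫ (incl Φ).map ι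
  have hτz : τ ≫ z = 0 := by
    rw [Preadditive.sub_comp, Category.assoc, hτ₀, hι, sub_self]
  have hτ : ∀ {X : A} (x : X ⟶ V), (incl Φ).map x ≫ τ =
      (incl Φ).map (x ≫ τ₀) - t Φ X ≫ (incl Φ).map (F.map x ≫ ι) := by
    intro X x
    rw [Preadditive.comp_sub, ← Functor.map_comp, ← Category.assoc, incl_comp_t, Category.assoc,
      ← Functor.map_comp]
  refine CokerPdLE.of_shortExact (b := (incl Φ).map b) (a := (incl Φ).map a) (τ := τ) (c := c)
    (fun {X} ψ => ⟨?_, ?_⟩) (fun {X} φ => (hc X φ).symm.trans ⟨?_, ?_⟩)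
    (Hb.map (incl Φ) hwk incl_isWeakKernel) (Ha.map (incl Φ) hwk incl_isWeakKernel)
  · obtain ⟨X, rfl⟩ : ∃ X', (incl Φ).obj X' = X := ⟨X.obj, rfl⟩
    rintro ⟨χ, hχ⟩
    obtain ⟨m, hm⟩ := exists_degLT ψ
    induction m generalizing X with
    | zero => exact ⟨0, Limits.zero_comp.trans hm.symm⟩
    | succ m ih =>
      obtain ⟨ψ₀, ψ', rfl, hψ'⟩ := hm
      obtain ⟨k, hk⟩ := exists_degLT χ
      obtain ⟨χ₀, χ', rfl, -⟩ := hk.succ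
      have h := eq_zero_of_incl_add_t_comp (f := χ₀ ≫ a - ψ₀ ≫ τ₀)
        (g := χ' ≫ (incl Φ).map a + (incl Φ).map (F.map ψ₀ ≫ ι) - ψ' ≫ τ) (by
          rw [Preadditive.add_comp, Preadditive.add_comp, hτ, Category.assoc, Category.assoc,
            ← Functor.map_comp, ← sub_eq_zero] at hχ
          rw [← hχ, Functor.map_sub, Preadditive.comp_sub, Preadditive.comp_add]
          abel)
      -- Injectivity on the lowest coefficient: `ψ₀ ≫ τ₀` is a relation on `z`, so `t` times the
      -- multiple of `w` vanishes and `ψ₀` is a relation on `w`. The leftover `ι` term is then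
      -- itself a relation on `z` and is absorbed into `χ'`.
      have h₁ : (incl Φ).map (F.map ψ₀) ≫ w = 0 := t_comp_injective (by
        rw [← ht, ← sub_eq_zero.1 h.1, Functor.map_comp, Category.assoc, haz, Limits.comp_zero,
          Limits.comp_zero])
      obtain ⟨x, rfl⟩ := (hb _ ψ₀).1 h₁
      obtain ⟨y, hy⟩ := (ha _ (F.map (x ≫ b) ≫ ι)).1 (by rw [hi, h₁])
      obtain ⟨x', rfl⟩ := ih _ ψ' (χ' + (incl Φ).map y) (by
        rw [Preadditive.add_comp, ← Functor.map_comp, hy]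
        exact sub_eq_zero.1 h.2) hψ'
      exact ⟨(incl Φ).map x + t Φ X ≫ x', by
        rw [Preadditive.add_comp, Functor.map_comp, Category.assoc]⟩
  · rintro ⟨χ, rfl⟩
    obtain ⟨x, hx⟩ := (ha _ (b ≫ τ₀)).1 (by rw [ht, hbw, Limits.comp_zero])
    obtain ⟨y, hy⟩ := (ha _ (F.map b ≫ ι)).1 (by rw [hi, hbw])
    refine ⟨χ ≫ ((incl Φ).map x - t Φ V₁ ≫ (incl Φ).map y), ?_⟩
    rw [Category.assoc, Category.assoc, hτ, ← hx, ← hy, Preadditive.sub_comp, Category.assoc,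
      Functor.map_comp, Functor.map_comp]
  · obtain ⟨X, rfl⟩ : ∃ X', (incl Φ).obj X' = X := ⟨X.obj, rfl⟩
    intro hφ
    obtain ⟨m, hm⟩ := exists_degLT φ
    induction m generalizing X with
    | zero =>
      obtain rfl : φ = 0 := hm
      exact ⟨0, 0, by rw [Limits.zero_comp, Limits.zero_comp, sub_zero]⟩
    | succ m ih =>
      obtain ⟨φ₀, φ', rfl, hφ'⟩ := hm
      -- A constant `φ` is directly a relation on `z`. It is treated apart because the other case
      -- subtracts a constant from `φ'`, which must not raise its degree bound.
      cases m with
      | zero =>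
        obtain rfl : φ' = 0 := hφ'
        rw [Limits.comp_zero, add_zero] at hφ ⊢
        obtain ⟨y, rfl⟩ := (ha _ φ₀).1 hφ
        exact ⟨0, (incl Φ).map y, by rw [Limits.zero_comp, sub_zero, Functor.map_comp]⟩
      | succ m =>
        rw [Preadditive.add_comp, Category.assoc] at hφ
        -- From `φ₀ z + t φ' z = 0`, the element `t φ' z` has degree at most `n`, so `φ' z` lies in
        -- `K_{<n}` and is a multiple of `w`. Modulo `τ` this trades the constant term of `φ` for a
        -- relation and leaves a polynomial of lower degree bound.
        obtain ⟨x, hx⟩ := hwgen X (φ' ≫ z) ⟨K.comp_mem _ hz.1, DegLT.of_t_comp (by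
          rw [← neg_eq_of_add_eq_zero_right hφ]
          exact (hz.2.incl_comp φ₀).neg)⟩
        obtain ⟨y, hy⟩ := (ha _ (φ₀ + x ≫ τ₀)).1 (by
          rw [Functor.map_add, Preadditive.add_comp, ht, hx, hφ])
        obtain ⟨ψ, χ, h⟩ := ih _ (φ' - (incl Φ).map (F.map x ≫ ι)) (by
          rw [Preadditive.sub_comp, hi, hx, sub_self])
          (hφ'.sub ((incl_map_degLT _).mono (by omega)))
        refine ⟨t Φ X ≫ ψ - (incl Φ).map x, (incl Φ).map y + t Φ X ≫ χ, ?_⟩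
        rw [Preadditive.add_comp, Category.assoc, h, ← Functor.map_comp, hy, Preadditive.sub_comp, hτ,
          Preadditive.comp_sub, Preadditive.comp_sub, Functor.map_add, Category.assoc]
        abel
  · rintro ⟨ψ, χ, h⟩
    rw [sub_eq_iff_eq_add.1 h.symm, Preadditive.add_comp, Category.assoc, Category.assoc, haz, hτz,
      Limits.comp_zero, Limits.comp_zero, add_zero]

end TwistedPolynomial

theorem mainTheorem9 {A : Type u} [Category.{v} A] [Preadditive A] [Limits.HasBinaryBiproducts A]
    (Φ : AdditiveAutomorphism A) (l : ℕ) :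
    ((IsRegularCat A → IsRegularCat (TwistedPolynomial Φ)) ∧
      (IsUniformlyRegularCat A l → IsUniformlyRegularCat (TwistedPolynomial Φ) (l + 2))) ∧
    ((IsRegularCat (TwistedPolynomial Φ) → IsRegularCat (TwistedLaurent Φ)) ∧
      (IsUniformlyRegularCat (TwistedPolynomial Φ) l →
        IsUniformlyRegularCat (TwistedLaurent Φ) l)) := by
  -- The reduction to one generator needs an object. Over an empty category every module is zero.
  rcases isEmpty_or_nonempty A with hA | ⟨⟨X⟩⟩
  · have : IsEmpty (TwistedPolynomial Φ) := ⟨fun X => hA.elim X.obj⟩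
    have : IsEmpty (TwistedLaurent Φ) := ⟨fun X => hA.elim X.obj⟩
    exact ⟨⟨fun _ => (isUniformlyRegularCat_of_isEmpty 0).isRegularCat,
      fun _ => isUniformlyRegularCat_of_isEmpty _⟩,
      fun _ => (isUniformlyRegularCat_of_isEmpty 0).isRegularCat,
      fun _ => isUniformlyRegularCat_of_isEmpty _⟩
  have : Nonempty A := ⟨X⟩
  have : Nonempty (TwistedPolynomial Φ) := ⟨⟨X⟩⟩
  have : Nonempty (TwistedLaurent Φ) := ⟨⟨X⟩⟩
  simp only [isRegularCat_iff, isUniformlyRegularCat_iff]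
  refine ⟨⟨fun ⟨h, H⟩ => ⟨TwistedPolynomial.hasPrincipalIdeals h, fun d => ?_⟩,
    fun ⟨h, H⟩ => ⟨TwistedPolynomial.hasPrincipalIdeals h, fun d => ?_⟩⟩,
    fun ⟨h, H⟩ => ⟨TwistedPolynomial.hasPrincipalIdeals_laurent h, fun d => ?_⟩,
    fun ⟨h, H⟩ => ⟨TwistedPolynomial.hasPrincipalIdeals_laurent h, fun d => ?_⟩⟩
  · obtain ⟨_, _, _, _, b, a, hd⟩ := TwistedPolynomial.exists_cokerPdLE h d
    obtain ⟨n, hn⟩ := H b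
    obtain ⟨m, hm⟩ := H a
    -- The bounds for the two presentations over `A` may differ; a common one is used for both.
    exact ⟨_, hd (max n m) (hn.mono (le_max_left _ _)) (hm.mono (by omega))⟩
  · obtain ⟨_, _, _, _, b, a, hd⟩ := TwistedPolynomial.exists_cokerPdLE h d
    exact hd l (H b) ((H a).mono l.le_succ)
  · obtain ⟨_, g, hg⟩ := TwistedPolynomial.cokerPdLE_laurent h d
    obtain ⟨n, hn⟩ := H g
    exact ⟨n, hg n hn⟩
  · obtain ⟨_, g, hg⟩ := TwistedPolynomial.cokerPdLE_laurent h d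
    exact hg l (H g)
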